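/- Let $\Delta$ be a $(d-1)$-dimensional simplex, linearly embedded in a real vector space, with $d\ge 3$, and let $\Gamma$ be a geometric triangulation of $\Delta$, i.e. a finite geometric simplicial complex with underlying space $\Delta$. For a face $F$ of $\Delta$ (possibly empty) with $n$ vertices, let $\Gamma_F$ be the subcomplex of faces of $\Gamma$ contained in $F$, let $h(\Gamma_F;x)=\sum_{i=0}^{n} f_{i-1}(\Gamma_F)\,x^i(1-x)^{n-i}$ be its $h$-polynomial, where $f_{-1}=1$ and $f_j$ is the number of $j$-dimensional faces, and let $$\ell(\Gamma;x)=\sum_{F\le\Delta}(-1)^{\operatorname{codim}F}\,h(\Gamma_F;x)=\ell_0+\ell_1x+\cdots+\ell_dx^d$$ be the local $h$-polynomial, where the sum is over all faces of $\Delta$ including $\varnothing$ and $\operatorname{codim}F=d-1-\dim F$. For a face $G$ of $\Gamma$ let $\sigma(G)$ be the smallest face of $\Delta$ containing $G$ (one says that $G$ is carried by $\sigma(G)$), and let $e(G)=\dim\sigma(G)-\dim G$ be its excess. The internal edge graph $\Sigma(\Gamma)$ is the graph whose edges are the edges of $\Gamma$ carried by $\Delta$ and whose vertices are the vertices incident to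 these edges. Suppose that $\ell_1=\ell_2=0$. Then for each connected component $C$ of $\Sigma(\Gamma)$, either 1. $C$ is a tree with exactly one vertex of excess less than $d-2$, or 2. $d=3$, every vertex of $C$ has excess $d-2=1$, and $C$ contains exactly one simple cycle, and this cycle has length $3$. In particular, if $d\ge 4$ (that is, $\dim\Delta\ge 3$), then every connected component of $\Sigma(\Gamma)$ is a tree containing exactly one vertex that is carried by a face of $\Delta$ of codimension at least $2$. -/

import Mathlib

namespace LocalH

variable {E : Type*} [AddCommGroup E] [Module ℝ E] {d : ℕ}

/-- The face, spanned by the vertices `v i` with `i ∈ F`, of the simplex with vertices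
`v 0, …, v (d - 1)`. If `v` is affinely independent, the simplex has dimension `d - 1`, and its
faces (the empty face included) correspond to the subsets `F` of `Fin d`. -/
def simplexFace (v : Fin d → E) (F : Finset (Fin d)) : Set E :=
  convexHull ℝ (v '' (F : Set (Fin d)))

/-- `Γ` is a (geometric) triangulation of the simplex with vertices `v 0, …, v (d - 1)`:
a finite geometric simplicial complex whose underlying space is that simplex. The faces of `Γ`
are given by their finite sets of vertices; Mathlib's complexes do not list the empty face. -/
structure IsTriangulation (v : Fin d → E) (Γ : Geometry.SimplicialComplex ℝ E) : Prop where
  finite_faces : Γ.faces.Finite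
  space_eq : Γ.space = simplexFace v Finset.univ

/-- The restriction `Γ_F` of `Γ` to a face `F` of the simplex: the subcomplex of all faces of `Γ`
that are contained in `F`. -/
def restrict (v : Fin d → E) (Γ : Geometry.SimplicialComplex ℝ E) (F : Finset (Fin d)) :
    Geometry.SimplicialComplex ℝ E where
  faces := {G | G ∈ Γ.faces ∧ convexHull ℝ (G : Set E) ⊆ simplexFace v F}
  indep hs := Γ.indep hs.1
  isRelLowerSet_faces := by
    intro s hs
    refine ⟨Γ.nonempty_of_mem_faces hs.1, fun t hts ht => ⟨Γ.down_closed hs.1 hts ht, ?_⟩⟩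
    exact (convexHull_mono (Finset.coe_subset.2 hts)).trans hs.2
  inter_subset_convexHull hs ht := Γ.inter_subset_convexHull hs.1 ht.1

/-- `faceCount K i` is the number `f_{i-1}` of faces of `K` with `i` vertices, i.e. of dimension
`i - 1`; the empty face is counted, so `f_{-1} = 1`. -/
noncomputable def faceCount (K : Geometry.SimplicialComplex ℝ E) (i : ℕ) : ℕ :=
  if i = 0 then 1 else {G : Finset E | G ∈ K.faces ∧ G.card = i}.ncard

/-- The `h`-polynomial of a finite complex `K` of dimension `n - 1`:
`h(K; x) = ∑_{i=0}^n f_{i-1} x^i (1 - x)^{n-i}`. -/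
noncomputable def hPoly (K : Geometry.SimplicialComplex ℝ E) (n : ℕ) : Polynomial ℤ :=
  ∑ i ∈ Finset.range (n + 1),
    Polynomial.C (faceCount K i : ℤ) * Polynomial.X ^ i * (1 - Polynomial.X) ^ (n - i)

/-- The defining equation `∑ h_i (x + 1)^{n-i} = ∑ f_{i-1} x^{n-i}` of the `h`-polynomial. -/
theorem hPoly_spec (K : Geometry.SimplicialComplex ℝ E) (n : ℕ) :
    ∑ i ∈ Finset.range (n + 1),
        Polynomial.C ((hPoly K n).coeff i) * (Polynomial.X + 1) ^ (n - i) =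
      ∑ i ∈ Finset.range (n + 1), Polynomial.C (faceCount K i : ℤ) * Polynomial.X ^ (n - i) := by
  have key : ∀ m i : ℕ, ∑ j ∈ Finset.range (i + m + 1),
      Polynomial.C ((Polynomial.X ^ i * (1 - Polynomial.X : Polynomial ℤ) ^ m).coeff j) * (Polynomial.X + 1) ^ (i + m - j) = (Polynomial.X : Polynomial ℤ) ^ m := by
    intro m i
    induction m with
    | zero =>
      rw [Finset.sum_eq_single i] <;> simp +contextual [Polynomial.coeff_X_pow]
    | succ m ih =>
      have e : Polynomial.X ^ i * (1 - Polynomial.X : Polynomial ℤ) ^ (m + 1) = Polynomial.X ^ i * (1 - Polynomial.X) ^ m - Polynomial.X * (Polynomial.X ^ i * (1 - Polynomial.X) ^ m) := by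
        ring
      have hdeg : (Polynomial.X ^ i * (1 - Polynomial.X : Polynomial ℤ) ^ m).coeff (i + m + 1) = 0 := by
        apply Polynomial.coeff_eq_zero_of_natDegree_lt
        have : (Polynomial.X ^ i * (1 - Polynomial.X : Polynomial ℤ) ^ m).natDegree ≤ i + m := by compute_degree!
        omega
      simp only [e, Polynomial.coeff_sub, Polynomial.C_sub, sub_mul, Finset.sum_sub_distrib]
      rw [← add_assoc, Finset.sum_range_succ, hdeg,
        Finset.sum_range_succ' _ (i + m + 1)]
      simp only [Polynomial.coeff_X_mul, Nat.add_sub_add_right, ih]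
      have : ∑ j ∈ Finset.range (i + m + 1), Polynomial.C ((Polynomial.X ^ i * (1 - Polynomial.X : Polynomial ℤ) ^ m).coeff j) *
          (Polynomial.X + 1) ^ (i + m + 1 - j) = (Polynomial.X + 1) * Polynomial.X ^ m := by
        rw [← ih, Finset.mul_sum]
        refine Finset.sum_congr rfl fun j hj => ?_
        rw [show i + m + 1 - j = (i + m - j) + 1 by grind, pow_succ]; ring
      rw [this]; simp; ring
  simp only [hPoly, Polynomial.finsetSum_coeff, map_sum, Finset.sum_mul]
  rw [Finset.sum_comm]
  refine Finset.sum_congr rfl fun i hi => ?_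
  have h := key (n - i) i
  rw [show i + (n - i) = n by grind] at h
  rw [← h, Finset.mul_sum]
  refine Finset.sum_congr rfl fun j hj => ?_
  rw [mul_assoc, Polynomial.coeff_C_mul, Polynomial.C_mul, mul_assoc]

/-- The local `h`-polynomial `ℓ(Γ_F; x) = ∑_{F' ≤ F} (-1)^{dim F - dim F'} h(Γ_{F'}; x)` of the
restriction of `Γ` to the face `F`. The sum includes the empty face `F'`. -/
noncomputable def localHFace (v : Fin d → E) (Γ : Geometry.SimplicialComplex ℝ E)
    (F : Finset (Fin d)) : Polynomial ℤ :=
  ∑ F' ∈ F.powerset, (-1) ^ (F.card - F'.card) * hPoly (restrict v Γ F') F'.card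

/-- The local `h`-polynomial `ℓ(Γ; x)` of `Γ`. -/
noncomputable def localH (v : Fin d → E) (Γ : Geometry.SimplicialComplex ℝ E) : Polynomial ℤ :=
  localHFace v Γ Finset.univ

/-- The characterization of local `h`-polynomials by Möbius inversion:
`h(Γ_F; x) = ∑_{F' ≤ F} ℓ(Γ_{F'}; x)` for all faces `F`. -/
theorem hPoly_eq_sum_localHFace (v : Fin d → E) (Γ : Geometry.SimplicialComplex ℝ E)
    (F : Finset (Fin d)) :
    hPoly (restrict v Γ F) F.card = ∑ F' ∈ F.powerset, localHFace v Γ F' := by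
  simp only [localHFace]
  rw [Finset.sum_comm' (t' := F.powerset) (s' := fun G => Finset.Icc G F) (by
    intro x y; simp only [Finset.mem_powerset, Finset.mem_Icc]
    exact ⟨fun h => ⟨⟨h.2, h.1⟩, h.2.trans h.1⟩, fun h => ⟨h.1.2, h.1.1⟩⟩)]
  have key : ∀ G ∈ F.powerset, ∑ F' ∈ Finset.Icc G F, (-1 : Polynomial ℤ) ^ (F'.card - G.card) * hPoly (restrict v Γ G) G.card
      = if F = G then hPoly (restrict v Γ G) G.card else 0 := by
    intro G hG
    rw [Finset.mem_powerset] at hG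
    rw [← Finset.sum_mul, Finset.Icc_eq_image_powerset hG, Finset.sum_image]
    · have e : ∑ x ∈ (F \ G).powerset, (-1 : Polynomial ℤ) ^ ((G ∪ x).card - G.card)
          = ((∑ x ∈ (F \ G).powerset, (-1 : ℤ) ^ x.card : ℤ) : Polynomial ℤ) := by
        push_cast
        refine Finset.sum_congr rfl fun x hx => ?_
        rw [Finset.card_union_of_disjoint, Nat.add_sub_cancel_left]
        exact (Finset.disjoint_of_subset_left (Finset.mem_powerset.1 hx) Finset.sdiff_disjoint).symm
      rw [e, Finset.sum_powerset_neg_one_pow_card]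
      by_cases hF : F = G
      · simp [hF]
      · have : ¬ F ⊆ G := fun h' => hF (h'.antisymm hG)
        simp [hF, this, Finset.sdiff_eq_empty_iff_subset]
    · intro x hx y hy hxy
      have hx' := Finset.mem_powerset.1 hx
      have hy' := Finset.mem_powerset.1 hy
      have hxy' : G ∪ x = G ∪ y := hxy
      ext w
      have := Finset.ext_iff.1 hxy' w
      grind
  rw [Finset.sum_congr rfl key]
  simp

open Classical in
/-- The smallest face `σ(G)` of the simplex that contains `G`, as the intersection of all faces
that contain `G`; `G` is said to be carried by `σ(G)`. -/
noncomputable def carrier (v : Fin d → E) (G : Finset E) : Finset (Fin d) :=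
  Finset.univ.filter fun i =>
    ∀ F : Finset (Fin d), convexHull ℝ (G : Set E) ⊆ simplexFace v F → i ∈ F

/-- The dimension of the simplex spanned by a finite (affinely independent) set of vertices. -/
def simplexDim {α : Type*} (G : Finset α) : ℤ := (G.card : ℤ) - 1

/-- The excess `e(G) = dim σ(G) - dim G`. -/
noncomputable def excess (v : Fin d → E) (G : Finset E) : ℤ :=
  simplexDim (carrier v G) - simplexDim G

open Classical in
/-- The graph on all points of `E` whose edges are the edges of `Γ` carried by the whole
simplex. -/
def internalEdges (v : Fin d → E) (Γ : Geometry.SimplicialComplex ℝ E) : SimpleGraph E where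
  Adj x y := x ≠ y ∧ {x, y} ∈ Γ.faces ∧ carrier v {x, y} = Finset.univ
  symm := ⟨fun x y h => ⟨h.1.symm, by rw [Finset.pair_comm]; exact h.2⟩⟩
  loopless := ⟨fun _ h => h.1 rfl⟩

/-- The internal edge graph `Σ(Γ)`: its edges are the edges of `Γ` carried by the whole simplex,
its vertices are the points incident to these edges. -/
def internalEdgeGraph (v : Fin d → E) (Γ : Geometry.SimplicialComplex ℝ E) :
    SimpleGraph (internalEdges v Γ).support :=
  (internalEdges v Γ).induce (internalEdges v Γ).support

/-- `G` has a unique simple cycle (as a subgraph), and this cycle has length 3. -/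
def HasUniqueSimpleThreeCycle {V : Type*} (G : SimpleGraph V) : Prop :=
  ∃ H : G.Subgraph,
    (∃ (u : V) (p : G.Walk u u), p.IsCycle ∧ p.length = 3 ∧ p.toSubgraph = H) ∧
      ∀ (u : V) (p : G.Walk u u), p.IsCycle → p.toSubgraph = H

end LocalH

namespace LocalH

open Geometry Filter Topology

variable {E : Type*} [AddCommGroup E] [Module ℝ E] {d : ℕ}

/-! ### Barycentric coordinates -/

/-! Inclusion-exclusion over the faces of $\Delta$ gives the low coefficients: $\ell_1$ counts the
vertices of $\Gamma$ interior to $\Delta$ (`coeff_localH_one`), and if there are none, $\ell_2$ is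
the number of internal edges minus the number of vertices interior to facets of $\Delta$
(`coeff_localH_two`). Let $W$ be the set of these facet vertices; all of them lie in
$\Sigma(\Gamma)$ (`mem_support_of_facet`). So the hypotheses say that $\Sigma(\Gamma)$ has exactly
$|W|$ edges.

If every component $C$ has a vertex outside $W$, then $|C\cap W|\le|C|-1\le e(C)$, where $e(C)$ is
the number of edges of $C$. Summing forces equality throughout, so each $C$ is a tree with one
vertex outside $W$ (`isTree_of_card_edgeSet_eq`).

Otherwise some component $C$ lies in $W$. Color its vertices by their facets. A vertex of $C$ and a
vertex off its facet, in a common face of $\Gamma$, span an internal edge, so the second vertex is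
in $C$ too. Hence the interior points of $\Delta$ whose smallest face meets $C$ form an open and
closed set, so all interior points qualify (`exists_hasColor`). It follows that $C$ is all of
$\Sigma(\Gamma)$ and has at most as many edges as vertices, hence at most one cycle.

To get triangles, fix a color $l$ and join two ridges $l\cap m$ and $l\cap m'$ inside facet $l$.
Interior points near this path always see $l$; they also see $m$ near one end and $m'$ near the
other. Somewhere a face must carry three colors including $l$ (`exists_three_colors`), and vertices
of different colors are joined by internal edges. Thus every color occurs on a triangle; all these
triangles are the unique cycle, so $d\le3$. -/

/-- An affine map giving barycentric coordinates with respect to the points `v i`. -/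
def IsCoord (v : Fin d → E) (co : E →ᵃ[ℝ] (Fin d → ℝ)) : Prop :=
  ∀ i, co (v i) = Pi.single i 1

/-- Affine independence is injectivity of $w\mapsto(\sum w_iv_i,\sum w_i)$; a linear left inverse
evaluated at $(x,1)$ gives the coordinates. -/
theorem exists_isCoord {v : Fin d → E} (hv : AffineIndependent ℝ v) :
    ∃ co : E →ᵃ[ℝ] (Fin d → ℝ), IsCoord v co := by
  let f : (Fin d → ℝ) →ₗ[ℝ] E × ℝ :=
    (Fintype.linearCombination ℝ v).prod (Fintype.linearCombination ℝ fun _ : Fin d => (1 : ℝ))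
  have hf : LinearMap.ker f = ⊥ := by
    rw [LinearMap.ker_eq_bot']
    intro w hw
    have h1 : ∑ i, w i • v i = 0 := by
      simpa [f, Fintype.linearCombination_apply] using congrArg Prod.fst hw
    have h2 : ∑ i, w i = 0 := by
      simpa [f, Fintype.linearCombination_apply] using congrArg Prod.snd hw
    ext i
    exact affineIndependent_iff.1 hv Finset.univ w h2 h1 i (Finset.mem_univ i)
  obtain ⟨g, hg⟩ := f.exists_leftInverse_of_injective hf
  refine ⟨(g ∘ₗ LinearMap.inl ℝ E ℝ).toAffineMap + AffineMap.const ℝ E (g (0, 1)), fun i => ?_⟩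
  have h : f (Pi.single i 1) = (v i, 1) := by
    simp [f, Fintype.linearCombination_apply_single]
  have h' := LinearMap.congr_fun hg (Pi.single i 1)
  simp only [LinearMap.comp_apply, h, LinearMap.id_apply] at h'
  simp [← h', ← map_add]

variable {v : Fin d → E} {co : E →ᵃ[ℝ] (Fin d → ℝ)}

theorem map_convex_sum {ι : Type*} (co : E →ᵃ[ℝ] (Fin d → ℝ)) (s : Finset ι) (w : ι → ℝ)
    (p : ι → E) (hw : ∑ i ∈ s, w i = 1) : co (∑ i ∈ s, w i • p i) = ∑ i ∈ s, w i • co (p i) := by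
  have h : ∀ x, co x = co.linear x + co 0 := fun x => by
    rw [AffineMap.decomp' co]; simp
  rw [h, map_sum, Finset.sum_congr rfl fun i _ => congrArg (w i • ·) (h (p i))]
  simp [smul_add, Finset.sum_add_distrib, ← Finset.sum_smul, hw]

theorem IsCoord.apply_linearCombination (hco : IsCoord v co) {y : Fin d → ℝ}
    (hy : y ∈ stdSimplex ℝ (Fin d)) : co (Fintype.linearCombination ℝ v y) = y := by
  rw [Fintype.linearCombination_apply, map_convex_sum _ _ _ _ hy.2]
  ext i
  simp [hco _, Finset.sum_apply, Pi.single_apply]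

theorem mem_simplexFace_iff_exists {F : Finset (Fin d)} {x : E} :
    x ∈ simplexFace v F ↔ ∃ y ∈ stdSimplex ℝ (Fin d), (∀ i ∉ F, y i = 0) ∧
      Fintype.linearCombination ℝ v y = x := by
  constructor
  · intro hx
    have hconv : Convex ℝ {x : E | ∃ y ∈ stdSimplex ℝ (Fin d), (∀ i ∉ F, y i = 0) ∧
        Fintype.linearCombination ℝ v y = x} := by
      rintro _ ⟨y, hy, hy0, rfl⟩ _ ⟨z, hz, hz0, rfl⟩ a b ha hb hab
      refine ⟨a • y + b • z, convex_stdSimplex ℝ _ hy hz ha hb hab, fun i hi => ?_, by simp⟩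
      simp [hy0 i hi, hz0 i hi]
    refine convexHull_min ?_ hconv hx
    rintro _ ⟨i, hi, rfl⟩
    refine ⟨Pi.single i 1, single_mem_stdSimplex ℝ i, fun j hj => ?_, by simp [Fintype.linearCombination_apply_single]⟩
    exact Pi.single_eq_of_ne (by rintro rfl; exact hj hi) _
  · rintro ⟨y, hy, hy0, rfl⟩
    rw [Fintype.linearCombination_apply, ← Finset.sum_subset (Finset.subset_univ F)
      (fun i _ hi => by simp [hy0 i hi])]
    refine (convex_convexHull ℝ _).sum_mem (fun i _ => hy.1 i) ?_
      (fun i hi => subset_convexHull ℝ _ ⟨i, hi, rfl⟩)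
    rw [Finset.sum_subset (Finset.subset_univ F) (fun i _ hi => by simp [hy0 i hi])]
    exact hy.2

/-- Off the affine span of `v` the values of `co` are arbitrary, so membership must also require
that the coordinates reconstruct `x`. -/
theorem IsCoord.mem_simplexFace_iff (hco : IsCoord v co) {F : Finset (Fin d)} {x : E} :
    x ∈ simplexFace v F ↔ (co x ∈ stdSimplex ℝ (Fin d) ∧
      Fintype.linearCombination ℝ v (co x) = x) ∧ ∀ i ∉ F, co x i = 0 := by
  rw [mem_simplexFace_iff_exists]
  constructor
  · rintro ⟨y, hy, hy0, rfl⟩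
    rw [hco.apply_linearCombination hy]
    exact ⟨⟨hy, rfl⟩, hy0⟩
  · rintro ⟨⟨h1, h2⟩, h3⟩
    exact ⟨_, h1, h3, h2⟩

variable {Γ : SimplicialComplex ℝ E}

theorem IsTriangulation.mem_simplexFace (hΓ : IsTriangulation v Γ) {G : Finset E}
    (hG : G ∈ Γ.faces) {x : E} (hx : x ∈ convexHull ℝ (G : Set E)) :
    x ∈ simplexFace v Finset.univ :=
  hΓ.space_eq ▸ SimplicialComplex.convexHull_subset_space hG hx

theorem IsTriangulation.mem_simplexFace_of_mem (hΓ : IsTriangulation v Γ) {G : Finset E}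
    (hG : G ∈ Γ.faces) {x : E} (hx : x ∈ G) : x ∈ simplexFace v Finset.univ :=
  hΓ.mem_simplexFace hG (subset_convexHull ℝ _ hx)

theorem IsTriangulation.coord_nonneg (hΓ : IsTriangulation v Γ) (hco : IsCoord v co)
    {G : Finset E} (hG : G ∈ Γ.faces) {x : E} (hx : x ∈ G) (i : Fin d) : 0 ≤ co x i :=
  ((hco.mem_simplexFace_iff.1 (hΓ.mem_simplexFace_of_mem hG hx)).1.1).1 i

theorem IsTriangulation.convexHull_subset_simplexFace_iff (hΓ : IsTriangulation v Γ)
    (hco : IsCoord v co) {G : Finset E} (hG : G ∈ Γ.faces) {F : Finset (Fin d)} :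
    convexHull ℝ (G : Set E) ⊆ simplexFace v F ↔ ∀ x ∈ G, ∀ i ∉ F, co x i = 0 := by
  constructor
  · intro h x hx
    exact (hco.mem_simplexFace_iff.1 (h (subset_convexHull ℝ _ hx))).2
  · intro h
    refine convexHull_min (fun x hx => ?_) (convex_convexHull ℝ _)
    exact hco.mem_simplexFace_iff.2
      ⟨(hco.mem_simplexFace_iff.1 (hΓ.mem_simplexFace_of_mem hG hx)).1, h x hx⟩

theorem IsTriangulation.mem_carrier_iff (hΓ : IsTriangulation v Γ) (hco : IsCoord v co)
    {G : Finset E} (hG : G ∈ Γ.faces) {i : Fin d} :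
    i ∈ carrier v G ↔ ∃ x ∈ G, co x i ≠ 0 := by
  classical
  simp only [carrier, Finset.mem_filter, Finset.mem_univ, true_and,
    hΓ.convexHull_subset_simplexFace_iff hco hG]
  constructor
  · intro h
    have := h (Finset.univ.filter fun i => ∃ x ∈ G, co x i ≠ 0) (fun x hx j hj => by
      by_contra h0
      exact hj (by simpa using ⟨x, hx, h0⟩))
    simpa using this
  · rintro ⟨x, hx, h0⟩ F hF
    by_contra hi
    exact h0 (hF x hx i hi)

theorem IsTriangulation.carrier_subset_iff (hΓ : IsTriangulation v Γ) (hco : IsCoord v co)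
    {G : Finset E} (hG : G ∈ Γ.faces) {F : Finset (Fin d)} :
    convexHull ℝ (G : Set E) ⊆ simplexFace v F ↔ carrier v G ⊆ F := by
  rw [hΓ.convexHull_subset_simplexFace_iff hco hG]
  constructor
  · intro h i hi
    obtain ⟨x, hx, h0⟩ := (hΓ.mem_carrier_iff hco hG).1 hi
    by_contra hF
    exact h0 (h x hx i hF)
  · intro h x hx i hi
    by_contra h0
    exact hi (h ((hΓ.mem_carrier_iff hco hG).2 ⟨x, hx, h0⟩))

/-! ### The smallest face of the triangulation through a point -/

/-- The faces through a point are closed under intersection, so one of least cardinality lies in all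
the others. -/
theorem exists_minimal_face {x : E} (hx : x ∈ Γ.space) :
    ∃ G ∈ Γ.faces, x ∈ convexHull ℝ (G : Set E) ∧
      ∀ H ∈ Γ.faces, x ∈ convexHull ℝ (H : Set E) → G ⊆ H := by
  classical
  obtain ⟨G₀, hG₀, hx₀⟩ := SimplicialComplex.mem_space_iff.1 hx
  obtain ⟨G, ⟨hG, hxG⟩, hmin⟩ := (measure (Finset.card : Finset E → ℕ)).wf.has_min
    {G | G ∈ Γ.faces ∧ x ∈ convexHull ℝ (G : Set E)} ⟨G₀, hG₀, hx₀⟩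
  refine ⟨G, hG, hxG, fun H hH hxH => ?_⟩
  have hI : x ∈ convexHull ℝ ((G ∩ H : Finset E) : Set E) := by
    rw [Finset.coe_inter]; exact Γ.inter_subset_convexHull hG hH ⟨hxG, hxH⟩
  have hne : (G ∩ H).Nonempty := by
    rw [← Finset.coe_nonempty, ← convexHull_nonempty_iff (𝕜 := ℝ)]; exact ⟨x, hI⟩
  have hle : ¬ (G ∩ H).card < G.card :=
    hmin _ ⟨Γ.down_closed hG Finset.inter_subset_left hne, hI⟩
  have := Finset.eq_of_subset_of_card_le (Finset.inter_subset_left (s₁ := G) (s₂ := H))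
    (not_lt.1 hle)
  exact this ▸ Finset.inter_subset_right

open Classical in
/-- The smallest face of the triangulation that contains the point with barycentric
coordinates `y`. -/
noncomputable def faceAt (v : Fin d → E) (Γ : SimplicialComplex ℝ E) (y : Fin d → ℝ) : Finset E :=
  if h : Fintype.linearCombination ℝ v y ∈ Γ.space then (exists_minimal_face h).choose else ∅

theorem IsTriangulation.linearCombination_mem (hΓ : IsTriangulation v Γ) {y : Fin d → ℝ}
    (hy : y ∈ stdSimplex ℝ (Fin d)) : Fintype.linearCombination ℝ v y ∈ Γ.space := by
  rw [hΓ.space_eq]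
  exact mem_simplexFace_iff_exists.2 ⟨y, hy, by simp, rfl⟩

theorem faceAt_spec (hΓ : IsTriangulation v Γ) {y : Fin d → ℝ}
    (hy : y ∈ stdSimplex ℝ (Fin d)) : faceAt v Γ y ∈ Γ.faces ∧
    Fintype.linearCombination ℝ v y ∈ convexHull ℝ (faceAt v Γ y : Set E) ∧
      ∀ H ∈ Γ.faces, Fintype.linearCombination ℝ v y ∈ convexHull ℝ (H : Set E) →
        faceAt v Γ y ⊆ H := by
  have h := hΓ.linearCombination_mem hy
  rw [faceAt, dif_pos h]
  exact (exists_minimal_face h).choose_spec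

theorem faceAt_mem_faces (hΓ : IsTriangulation v Γ) {y : Fin d → ℝ}
    (hy : y ∈ stdSimplex ℝ (Fin d)) : faceAt v Γ y ∈ Γ.faces := (faceAt_spec hΓ hy).1

theorem exists_mem_faceAt_coord_ne_zero (hΓ : IsTriangulation v Γ) {y : Fin d → ℝ}
    (hy : y ∈ stdSimplex ℝ (Fin d)) (hco : IsCoord v co) {i : Fin d} (hi : y i ≠ 0) :
    ∃ w ∈ faceAt v Γ y, co w i ≠ 0 := by
  obtain ⟨a, ha, ha1, hay⟩ := Finset.mem_convexHull'.1 (faceAt_spec hΓ hy).2.1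
  by_contra! h
  apply hi
  rw [← hco.apply_linearCombination hy, ← hay, map_convex_sum _ _ _ _ ha1, Finset.sum_apply]
  exact Finset.sum_eq_zero fun w hw => by simp [h w hw]

/-- By minimality every vertex of the smallest face has positive weight. A vanishing sum of
nonnegative terms then vanishes termwise. -/
theorem coord_eq_zero_of_mem_faceAt (hΓ : IsTriangulation v Γ) {y : Fin d → ℝ}
    (hy : y ∈ stdSimplex ℝ (Fin d)) (hco : IsCoord v co) {i : Fin d} (hi : y i = 0) {w : E}
    (hw : w ∈ faceAt v Γ y) : co w i = 0 := by
  classical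
  obtain ⟨hG, hyG, hmin⟩ := faceAt_spec hΓ hy
  obtain ⟨a, ha, ha1, hay⟩ := Finset.mem_convexHull'.1 hyG
  have hsum : ∑ x ∈ faceAt v Γ y, a x * co x i = 0 := by
    have hyi : co (Fintype.linearCombination ℝ v y) i = 0 := by
      rw [hco.apply_linearCombination hy, hi]
    rw [← hay, map_convex_sum _ _ _ _ ha1, Finset.sum_apply] at hyi
    simpa using hyi
  have h0 := (Finset.sum_eq_zero_iff_of_nonneg fun x hx =>
    mul_nonneg (ha x hx) (hΓ.coord_nonneg hco hG hx i)).1 hsum w hw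
  refine (mul_eq_zero.1 h0).resolve_left fun haw => ?_
  have h1 : ∑ x ∈ (faceAt v Γ y).erase w, a x = 1 := by
    rw [Finset.sum_erase _ haw, ha1]
  have h2 : ∑ x ∈ (faceAt v Γ y).erase w, a x • x = Fintype.linearCombination ℝ v y := by
    rw [Finset.sum_erase _ (by simp [haw]), hay]
  have hne : ((faceAt v Γ y).erase w).Nonempty := by
    rw [Finset.nonempty_iff_ne_empty]
    rintro h
    simp [h] at h1
  have := hmin _ (Γ.down_closed hG (Finset.erase_subset _ _) hne)
    (Finset.mem_convexHull'.2 ⟨a, fun x hx => ha x (Finset.mem_of_mem_erase hx), h1, h2⟩)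
  exact absurd (this hw) (Finset.notMem_erase _ _)

/-- The finitely many simplices that miss `y` are closed, so they miss all nearby points. The
smallest face of a nearby point therefore contains `y`. -/
theorem eventually_faceAt_subset (hΓ : IsTriangulation v Γ) {y : Fin d → ℝ}
    (hy : y ∈ stdSimplex ℝ (Fin d)) (hco : IsCoord v co) :
    ∀ᶠ z in 𝓝[stdSimplex ℝ (Fin d)] y, faceAt v Γ y ⊆ faceAt v Γ z := by
  have key : ∀ G ∈ Γ.faces, Fintype.linearCombination ℝ v y ∉ convexHull ℝ (G : Set E) →
      ∀ᶠ z in 𝓝[stdSimplex ℝ (Fin d)] y,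
        Fintype.linearCombination ℝ v z ∉ convexHull ℝ (G : Set E) := by
    intro G hG hyG
    -- `E` carries no topology; closedness is tested on the coordinate image.
    have hcl : IsClosed (convexHull ℝ (co '' (G : Set E))) :=
      Set.Finite.isClosed_convexHull ℝ (G.finite_toSet.image _)
    rw [← AffineMap.image_convexHull] at hcl
    have hny : y ∈ (co '' convexHull ℝ (G : Set E))ᶜ := by
      rintro ⟨x, hx, rfl⟩
      apply hyG
      rwa [(hco.mem_simplexFace_iff.1 (hΓ.mem_simplexFace hG hx)).1.2]
    filter_upwards [mem_nhdsWithin_of_mem_nhds (hcl.isOpen_compl.mem_nhds hny),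
      self_mem_nhdsWithin] with z hz hzS hzG
    exact hz ⟨_, hzG, hco.apply_linearCombination hzS⟩
  have hall : ∀ᶠ z in 𝓝[stdSimplex ℝ (Fin d)] y, ∀ G ∈ Γ.faces,
      Fintype.linearCombination ℝ v y ∉ convexHull ℝ (G : Set E) →
        Fintype.linearCombination ℝ v z ∉ convexHull ℝ (G : Set E) := by
    rw [Filter.eventually_all_finite hΓ.finite_faces]
    intro G hG
    by_cases h : Fintype.linearCombination ℝ v y ∈ convexHull ℝ (G : Set E)
    · exact Filter.Eventually.of_forall fun z h' => absurd h h'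
    · filter_upwards [key G hG h] with z hz _ using hz
  filter_upwards [hall, self_mem_nhdsWithin] with z hz hzS
  obtain ⟨hG, hzG, -⟩ := faceAt_spec hΓ hzS
  refine (faceAt_spec hΓ hy).2.2 _ hG ?_
  by_contra h
  exact hz _ hG h hzG

/-! ### The open simplex and approximation from the interior -/

/-- The relative interior of the standard simplex. -/
def openSimplex (d : ℕ) : Set (Fin d → ℝ) := {y ∈ stdSimplex ℝ (Fin d) | ∀ i, 0 < y i}

theorem openSimplex_subset : openSimplex d ⊆ stdSimplex ℝ (Fin d) := fun _ h => h.1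

/-- The barycenter of the standard simplex. -/
noncomputable def barycenter (d : ℕ) : Fin d → ℝ := fun _ => (d : ℝ)⁻¹

theorem convex_openSimplex : Convex ℝ (openSimplex d) := by
  rintro y ⟨hy, hy'⟩ z ⟨hz, hz'⟩ a b ha hb hab
  refine ⟨convex_stdSimplex ℝ _ hy hz ha hb hab, fun i => ?_⟩
  have h1 := hy' i
  have h2 := hz' i
  rcases ha.eq_or_lt with rfl | ha
  · have : b = 1 := by linarith
    simpa [this]
  · have := mul_pos ha h1
    have := mul_nonneg hb h2.le
    simp only [Pi.add_apply, Pi.smul_apply, smul_eq_mul]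
    linarith

theorem barycenter_mem [NeZero d] : barycenter d ∈ openSimplex d := by
  have hd : (0 : ℝ) < d := by exact_mod_cast Nat.pos_of_ne_zero (NeZero.ne d)
  refine ⟨⟨fun i => (inv_pos.2 hd).le, ?_⟩, fun i => inv_pos.2 hd⟩
  simp [barycenter, hd.ne']

theorem lineMap_mem_openSimplex [NeZero d] {y : Fin d → ℝ} (hy : y ∈ stdSimplex ℝ (Fin d)) {s : ℝ}
    (h0 : 0 < s) (h1 : s ≤ 1) : (1 - s) • y + s • barycenter d ∈ openSimplex d := by
  have hb := barycenter_mem (d := d)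
  refine ⟨convex_stdSimplex ℝ _ hy hb.1 (by linarith) h0.le (by ring), fun i => ?_⟩
  have := mul_pos h0 (hb.2 i)
  have := mul_nonneg (sub_nonneg.2 h1) (hy.1 i)
  simp only [Pi.add_apply, Pi.smul_apply, smul_eq_mul]
  linarith

theorem tendsto_lineMap_barycenter (y : Fin d → ℝ) :
    Tendsto (fun s : ℝ => (1 - s) • y + s • barycenter d) (𝓝[>] 0) (𝓝 y) := by
  have : Continuous fun s : ℝ => (1 - s) • y + s • barycenter d := by fun_prop
  have h := this.tendsto 0
  simp only [sub_zero, one_smul, zero_smul, add_zero] at h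
  exact h.mono_left nhdsWithin_le_nhds

theorem exists_mem_openSimplex [NeZero d] {y : Fin d → ℝ} (hy : y ∈ stdSimplex ℝ (Fin d))
    {P : (Fin d → ℝ) → Prop} (hP : ∀ᶠ z in 𝓝[stdSimplex ℝ (Fin d)] y, P z) :
    ∃ z ∈ openSimplex d, P z := by
  have hI : ∀ᶠ s : ℝ in 𝓝[>] 0, s ∈ Set.Ioo (0 : ℝ) 1 := Ioo_mem_nhdsGT one_pos
  have ht : Tendsto (fun s : ℝ => (1 - s) • y + s • barycenter d) (𝓝[>] 0)
      (𝓝[stdSimplex ℝ (Fin d)] y) := by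
    refine tendsto_nhdsWithin_iff.2 ⟨tendsto_lineMap_barycenter y, ?_⟩
    filter_upwards [hI] with s hs
    exact (lineMap_mem_openSimplex hy hs.1 hs.2.le).1
  obtain ⟨s, hs, hs'⟩ := (hI.and (ht.eventually hP)).exists
  exact ⟨_, lineMap_mem_openSimplex hy hs.1 hs.2.le, hs'⟩

theorem IsTriangulation.faceAt_subset (hΓ : IsTriangulation v Γ) (hco : IsCoord v co)
    {G : Finset E} (hG : G ∈ Γ.faces) {x : E} (hx : x ∈ convexHull ℝ (G : Set E)) :
    co x ∈ stdSimplex ℝ (Fin d) ∧ faceAt v Γ (co x) ⊆ G := by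
  obtain ⟨h1, h2⟩ := (hco.mem_simplexFace_iff.1 (hΓ.mem_simplexFace hG hx)).1
  exact ⟨h1, (faceAt_spec hΓ h1).2.2 G hG (h2.symm ▸ hx)⟩

theorem coord_midpoint (co : E →ᵃ[ℝ] (Fin d → ℝ)) (a b : E) (i : Fin d) :
    co (midpoint ℝ a b) i = (co a i + co b i) / 2 := by
  rw [AffineMap.map_midpoint, midpoint_eq_smul_add]
  simp; ring

end LocalH

namespace LocalH

open Geometry Filter Topology

variable {E : Type*} [AddCommGroup E] [Module ℝ E] {d : ℕ}
variable {v : Fin d → E} {co : E →ᵃ[ℝ] (Fin d → ℝ)} {Γ : SimplicialComplex ℝ E}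

/-! ### Families of facet vertices that are closed under internal edges -/

/-- `D` consists of points in relative interiors of facets of the simplex, `col w` being the index
of the facet of `w`, and `D` is closed under internal edges. -/
structure IsFacetFamily (co : E →ᵃ[ℝ] (Fin d → ℝ)) (Γ : SimplicialComplex ℝ E) (D : Set E)
    (col : E → Fin d) : Prop where
  coord_eq_zero_iff : ∀ w ∈ D, ∀ j, co w j = 0 ↔ j = col w
  mem_of_mem_face : ∀ G ∈ Γ.faces, ∀ w ∈ G, w ∈ D → ∀ w' ∈ G, co w' (col w) ≠ 0 → w' ∈ D

/-- The smallest face through the point with coordinates `y` has a vertex in `D` of color `l`. -/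
def HasColor (v : Fin d → E) (Γ : SimplicialComplex ℝ E) (D : Set E) (col : E → Fin d)
    (y : Fin d → ℝ) (l : Fin d) : Prop :=
  ∃ w ∈ faceAt v Γ y, w ∈ D ∧ col w = l

variable {D : Set E} {col : E → Fin d}

theorem HasColor.mono {y z : Fin d → ℝ} {l : Fin d} (h : HasColor v Γ D col y l)
    (hyz : faceAt v Γ y ⊆ faceAt v Γ z) : HasColor v Γ D col z l := by
  obtain ⟨w, hw, h⟩ := h
  exact ⟨w, hyz hw, h⟩

/-- Since $x_l\ne0$, the smaller face has a vertex off facet `l`; closure under internal edges puts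
it in `D`. With `x = z` interior, this says that seeing one color implies seeing two. -/
theorem IsFacetFamily.exists_hasColor_ne (hD : IsFacetFamily co Γ D col)
    (hΓ : IsTriangulation v Γ) (hco : IsCoord v co) {x z : Fin d → ℝ}
    (hx : x ∈ stdSimplex ℝ (Fin d)) (hz : z ∈ stdSimplex ℝ (Fin d))
    (hxz : faceAt v Γ x ⊆ faceAt v Γ z) {l : Fin d} (hl : HasColor v Γ D col z l)
    (hxl : x l ≠ 0) : ∃ k ≠ l, HasColor v Γ D col x k := by
  obtain ⟨w, hw, hwD, rfl⟩ := hl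
  obtain ⟨w', hw', h'⟩ := exists_mem_faceAt_coord_ne_zero hΓ hx hco hxl
  have hD' := hD.mem_of_mem_face _ (faceAt_mem_faces hΓ hz) w hw hwD w' (hxz hw') h'
  refine ⟨col w', fun h => h' ?_, w', hw', hD', rfl⟩
  rw [hD.coord_eq_zero_iff w' hD', h]

/-- Seeing a color is locally constant on the connected open simplex: it passes to nearby points by
monotonicity, and back by `exists_hasColor_ne`. -/
theorem IsFacetFamily.exists_hasColor (hD : IsFacetFamily co Γ D col)
    (hΓ : IsTriangulation v Γ) (hco : IsCoord v co) {x y : Fin d → ℝ} (hx : x ∈ openSimplex d)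
    (hy : y ∈ openSimplex d) (h : ∃ l, HasColor v Γ D col x l) :
    ∃ l, HasColor v Γ D col y l := by
  have hiff : (∃ l, HasColor v Γ D col x l) ↔ ∃ l, HasColor v Γ D col y l := by
    refine (convex_openSimplex (d := d)).isPreconnected.induction₂
      (fun x y => (∃ l, HasColor v Γ D col x l) ↔ ∃ l, HasColor v Γ D col y l)
      (fun x hx => ?_) (fun _ _ _ _ _ _ h h' => h.trans h') (fun _ _ _ _ h => h.symm) hx hy
    filter_upwards [nhdsWithin_mono x openSimplex_subset
      (eventually_faceAt_subset hΓ hx.1 hco), self_mem_nhdsWithin] with z hz hzO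
    refine ⟨fun ⟨l, hl⟩ => ⟨l, hl.mono hz⟩, fun ⟨l, hl⟩ => ?_⟩
    obtain ⟨k, -, hk⟩ := hD.exists_hasColor_ne hΓ hco hx.1 hzO.1 hz hl (hx.2 l).ne'
    exact ⟨k, hk⟩
  exact hiff.1 h

/-- The point of the relative interior of the codimension two face opposite to `l` and `m`. -/
noncomputable def ridgeCenter (l m : Fin d) : Fin d → ℝ :=
  fun i => if i = l ∨ i = m then 0 else ((d : ℝ) - 2)⁻¹

theorem ridgeCenter_mem (hd : 3 ≤ d) {l m : Fin d} (hlm : l ≠ m) :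
    ridgeCenter l m ∈ stdSimplex ℝ (Fin d) := by
  have hd' : (3 : ℝ) ≤ d := by exact_mod_cast hd
  have hpos : (0 : ℝ) < d - 2 := by linarith
  constructor
  · intro i
    unfold ridgeCenter
    split_ifs
    · exact le_rfl
    · exact (inv_pos.2 hpos).le
  · have h : (Finset.univ.filter fun i : Fin d => ¬ (i = l ∨ i = m)) = ({l, m} : Finset (Fin d))ᶜ := by
      ext i; simp
    simp only [ridgeCenter]
    rw [Finset.sum_ite, h, Finset.sum_const_zero, zero_add, Finset.sum_const, Finset.card_compl,
      Finset.card_pair hlm, Fintype.card_fin, nsmul_eq_mul, Nat.cast_sub (by omega)]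
    push_cast
    exact mul_inv_cancel₀ hpos.ne'

theorem ridgeCenter_pos (hd : 3 ≤ d) {l m i : Fin d} (hl : i ≠ l) (hm : i ≠ m) :
    0 < ridgeCenter l m i := by
  have hd' : (3 : ℝ) ≤ d := by exact_mod_cast hd
  simp only [ridgeCenter, hl, hm, or_self, if_false]
  exact inv_pos.2 (by linarith)

/-- Interior points near a facet see the color of the facet. -/
theorem IsFacetFamily.hasColor_of_facet [NeZero d] (hD : IsFacetFamily co Γ D col)
    (hΓ : IsTriangulation v Γ) (hco : IsCoord v co)
    (hall : ∀ y ∈ openSimplex d, ∃ l, HasColor v Γ D col y l) {x : Fin d → ℝ}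
    (hx : x ∈ stdSimplex ℝ (Fin d)) {l : Fin d} (hxl : x l = 0) (hxi : ∀ i ≠ l, x i ≠ 0) :
    HasColor v Γ D col x l := by
  obtain ⟨z, hz, hxz⟩ := exists_mem_openSimplex hx (eventually_faceAt_subset hΓ hx hco)
  obtain ⟨k, hk⟩ := hall z hz
  obtain ⟨k', hkl, hk⟩ : ∃ k ≠ l, HasColor v Γ D col z k := by
    by_cases hkl : k = l
    · subst hkl
      exact hD.exists_hasColor_ne hΓ hco hz.1 hz.1 subset_rfl hk (hz.2 _).ne'
    · exact ⟨k, hkl, hk⟩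
  obtain ⟨j, -, w, hw, hwD, -⟩ := hD.exists_hasColor_ne hΓ hco hx hz.1 hxz hk (hxi _ hkl)
  exact ⟨w, hw, hwD, ((hD.coord_eq_zero_iff w hwD l).1
    (coord_eq_zero_of_mem_faceAt hΓ hx hco hxl hw)).symm⟩

/-- Interior points near the codimension two face opposite to `l` and `m` see the colors `l` and
`m`. -/
theorem IsFacetFamily.hasColor_of_ridge (hD : IsFacetFamily co Γ D col)
    (hΓ : IsTriangulation v Γ) (hco : IsCoord v co)
    (hall : ∀ y ∈ openSimplex d, ∃ l, HasColor v Γ D col y l) {x z : Fin d → ℝ}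
    (hx : x ∈ stdSimplex ℝ (Fin d)) {l m : Fin d} (hlm : l ≠ m) (hxl : x l = 0) (hxm : x m = 0)
    (hxi : ∀ i, i ≠ l → i ≠ m → x i ≠ 0) (hz : z ∈ openSimplex d)
    (hxz : faceAt v Γ x ⊆ faceAt v Γ z) :
    HasColor v Γ D col z l ∧ HasColor v Γ D col z m := by
  have hsub : ∀ k, HasColor v Γ D col z k → k = l ∨ k = m := by
    intro k hk
    by_contra! h
    -- A third color would put a vertex of `D` on the ridge, where two coordinates vanish; points of
    -- `D` have only one zero coordinate.
    obtain ⟨j, -, w, hw, hwD, -⟩ := hD.exists_hasColor_ne hΓ hco hx hz.1 hxz hk (hxi _ h.1 h.2)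
    have h1 := (hD.coord_eq_zero_iff w hwD l).1 (coord_eq_zero_of_mem_faceAt hΓ hx hco hxl hw)
    have h2 := (hD.coord_eq_zero_iff w hwD m).1 (coord_eq_zero_of_mem_faceAt hΓ hx hco hxm hw)
    exact hlm (h1.trans h2.symm)
  obtain ⟨k, hk⟩ := hall z hz
  obtain ⟨k', hkk, hk'⟩ := hD.exists_hasColor_ne hΓ hco hz.1 hz.1 subset_rfl hk (hz.2 _).ne'
  rcases hsub k hk with rfl | rfl <;> rcases hsub k' hk' with rfl | rfl
  · exact absurd rfl hkk
  · exact ⟨hk, hk'⟩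
  · exact ⟨hk', hk⟩
  · exact absurd rfl hkk

/-- Without such a face, the color seen besides `l` would be unique, hence constant along a path
near facet `l` from one ridge to another, where it must change. -/
theorem IsFacetFamily.exists_three_colors (hd : 3 ≤ d) (hD : IsFacetFamily co Γ D col)
    (hΓ : IsTriangulation v Γ) (hco : IsCoord v co)
    (hall : ∀ y ∈ openSimplex d, ∃ l, HasColor v Γ D col y l) (l : Fin d) :
    ∃ G ∈ Γ.faces, ∃ a ∈ G, ∃ b ∈ G, ∃ c ∈ G, a ∈ D ∧ b ∈ D ∧ c ∈ D ∧
      col a = l ∧ col b ≠ l ∧ col c ≠ l ∧ col b ≠ col c := by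
  have : NeZero d := ⟨by omega⟩
  by_contra! hno
  have huniq : ∀ y ∈ openSimplex d, HasColor v Γ D col y l → ∀ j k, j ≠ l → k ≠ l →
      HasColor v Γ D col y j → HasColor v Γ D col y k → j = k := by
    rintro y hy ⟨a, ha, haD, hal⟩ j k hj hk ⟨b, hb, hbD, rfl⟩ ⟨c, hc, hcD, rfl⟩
    exact hno _ (faceAt_mem_faces hΓ hy.1) a ha b hb c hc haD hbD hcD hal hj hk
  obtain ⟨m, hm⟩ : ∃ m, m ≠ l := by
    have := Fin.nontrivial_iff_two_le.2 (show 2 ≤ d by omega)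
    exact exists_ne l
  obtain ⟨m', hml', hmm'⟩ : ∃ m', m' ≠ l ∧ m' ≠ m := by
    by_contra! h
    have : (Finset.univ : Finset (Fin d)) ⊆ {l, m} := fun i _ => by
      by_cases hi : i = l
      · simp [hi]
      · simp [h i hi]
    have := (Finset.card_le_card this).trans Finset.card_le_two
    rw [Finset.card_univ, Fintype.card_fin] at this
    omega
  have hx := ridgeCenter_mem hd hm.symm
  have hx' := ridgeCenter_mem hd hml'.symm
  set x := ridgeCenter l m with hxdef
  set x' := ridgeCenter l m' with hxdef'
  have hridge := fun z hz => hD.hasColor_of_ridge (z := z) hΓ hco hall hx hm.symm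
    (by simp [hxdef, ridgeCenter]) (by simp [hxdef, ridgeCenter])
    (fun i h1 h2 => (ridgeCenter_pos hd h1 h2).ne') hz
  have hridge' := fun z hz => hD.hasColor_of_ridge (z := z) hΓ hco hall hx' hml'.symm
    (by simp [hxdef', ridgeCenter]) (by simp [hxdef', ridgeCenter])
    (fun i h1 h2 => (ridgeCenter_pos hd h1 h2).ne') hz
  set z : ℝ → Fin d → ℝ := fun t => (1 - t) • x + t • x' with hz
  have hzS : ∀ t ∈ Set.Icc (0 : ℝ) 1, z t ∈ stdSimplex ℝ (Fin d) := fun t ht =>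
    convex_stdSimplex ℝ _ hx hx' (by linarith [ht.2]) ht.1 (by ring)
  -- The segment `z` from ridge to ridge in facet `l`, pushed into the interior by the parameter
  -- `s`.
  set g : ℝ → ℝ → Fin d → ℝ := fun s t => (1 - s) • z t + s • barycenter d with hg
  have hgc : Continuous fun p : ℝ × ℝ => g p.1 p.2 := by
    simp only [hg, hz]; fun_prop
  have hgO : ∀ s t, 0 < s → s ≤ 1 → t ∈ Set.Icc (0 : ℝ) 1 → g s t ∈ openSimplex d :=
    fun s t h0 h1 ht => lineMap_mem_openSimplex (hzS t ht) h0 h1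
  have hsee : ∀ t ∈ Set.Icc (0 : ℝ) 1, ∀ y ∈ openSimplex d, faceAt v Γ (z t) ⊆ faceAt v Γ y →
      HasColor v Γ D col y l := by
    intro t ht y hy hty
    rcases ht.1.eq_or_lt with rfl | h0
    · exact (hridge y hy (by simpa [hz] using hty)).1
    rcases ht.2.eq_or_lt with rfl | h1
    · exact (hridge' y hy (by simpa [hz] using hty)).1
    refine (hD.hasColor_of_facet hΓ hco hall (hzS t ht) ?_ fun i hi => ?_).mono hty
    · simp [hz, hxdef, hxdef', ridgeCenter]
    · have hxi := hx.1 i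
      have hxi' := hx'.1 i
      have h1' : 0 < 1 - t := by linarith
      simp only [hz, Pi.add_apply, Pi.smul_apply, smul_eq_mul]
      by_cases him : i = m
      · have := mul_pos h0 (ridgeCenter_pos hd hi (him.trans_ne hmm'.symm) : 0 < x' i)
        have := mul_nonneg h1'.le hxi
        linarith
      · have := mul_pos h1' (ridgeCenter_pos hd hi him : 0 < x i)
        have := mul_nonneg h0.le hxi'
        linarith
  -- Compactness of $[0,1]$ gives one `s` that works for all `t`.
  have hev : ∀ᶠ s : ℝ in 𝓝 0, ∀ t ∈ Set.Icc (0 : ℝ) 1, 0 < s → s ≤ 1 →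
      t ∈ Set.Icc (0 : ℝ) 1 → HasColor v Γ D col (g s t) l := by
    refine isCompact_Icc.eventually_forall_of_forall_eventually
      (P := fun s t => 0 < s → s ≤ 1 → t ∈ Set.Icc (0 : ℝ) 1 → HasColor v Γ D col (g s t) l)
      fun t ht => ?_
    have h := eventually_nhdsWithin_iff.1 (eventually_faceAt_subset hΓ (hzS t ht) hco)
    have hlim : Tendsto (fun p : ℝ × ℝ => g p.1 p.2) (𝓝 (0, t)) (𝓝 (z t)) := by
      have := hgc.tendsto (0, t)
      simpa [hg] using this
    filter_upwards [hlim.eventually h] with p hp h0 h1 hpt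
    have hO := hgO p.1 p.2 h0 h1 hpt
    exact hsee t ht _ hO (hp hO.1)
  have hend : ∀ t ∈ Set.Icc (0 : ℝ) 1, ∀ᶠ s : ℝ in 𝓝 0, 0 < s → s ≤ 1 →
      faceAt v Γ (z t) ⊆ faceAt v Γ (g s t) := by
    intro t ht
    have h := eventually_nhdsWithin_iff.1 (eventually_faceAt_subset hΓ (hzS t ht) hco)
    have hlim : Tendsto (fun s : ℝ => g s t) (𝓝 0) (𝓝 (z t)) := by
      have hc : Continuous fun s : ℝ => g s t := hgc.comp (by fun_prop : Continuous fun s : ℝ => (s, t))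
      have := hc.tendsto 0
      simpa [hg] using this
    filter_upwards [hlim.eventually h] with s hs h0 h1
    exact hs (hgO s t h0 h1 ht).1
  have h0m : (0 : ℝ) ∈ Set.Icc (0 : ℝ) 1 := ⟨le_rfl, zero_le_one⟩
  have h1m : (1 : ℝ) ∈ Set.Icc (0 : ℝ) 1 := ⟨zero_le_one, le_rfl⟩
  have hI : ∀ᶠ s : ℝ in 𝓝[>] 0, s ∈ Set.Ioo (0 : ℝ) 1 := Ioo_mem_nhdsGT one_pos
  obtain ⟨s, hs, hsl, hs0, hs1⟩ := (hI.and (((hev.and ((hend 0 h0m).and (hend 1 h1m)))).filter_mono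
    nhdsWithin_le_nhds)).exists
  have hsO := fun t => hgO s t hs.1 hs.2.le
  have hl : ∀ t ∈ Set.Icc (0 : ℝ) 1, HasColor v Γ D col (g s t) l := fun t ht =>
    hsl t ht hs.1 hs.2.le ht
  have hiff : HasColor v Γ D col (g s 0) m ↔ HasColor v Γ D col (g s 1) m := by
    refine isPreconnected_Icc.induction₂ (s := Set.Icc (0 : ℝ) 1)
      (fun t t' => HasColor v Γ D col (g s t) m ↔ HasColor v Γ D col (g s t') m)
      (fun t ht => ?_) (fun _ _ _ _ _ _ h h' => h.trans h') (fun _ _ _ _ h => h.symm) h0m h1m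
    have h := eventually_nhdsWithin_iff.1 (eventually_faceAt_subset hΓ (hsO t ht).1 hco)
    have hc : Continuous fun t : ℝ => g s t := hgc.comp (by fun_prop : Continuous fun t : ℝ => (s, t))
    filter_upwards [nhdsWithin_le_nhds ((hc.tendsto t).eventually h), self_mem_nhdsWithin]
      with t' h' ht'
    have hsub := h' (hsO t' ht').1
    refine ⟨fun hm => hm.mono hsub, fun hm' => ?_⟩
    -- Some color besides `l` is seen at `t` and persists at `t'`, where uniqueness identifies it
    -- with `m`.
    obtain ⟨k, hkl, hk⟩ := hD.exists_hasColor_ne hΓ hco (hsO t ht).1 (hsO t ht).1 subset_rfl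
      (hl t ht) ((hsO t ht).2 _).ne'
    rwa [← huniq _ (hsO t' ht') (hl t' ht') k m hkl hm (hk.mono hsub) hm']
  have hm0 := (hridge _ (hsO 0 h0m) (by simpa [hz] using hs0 hs.1 hs.2.le)).2
  have hm1 := (hridge' _ (hsO 1 h1m) (by simpa [hz] using hs1 hs.1 hs.2.le)).2
  exact hmm' (huniq _ (hsO 1 h1m) (hl 1 h1m) m' m hml' hm hm1 (hiff.1 hm0))

end LocalH

namespace LocalH

open Geometry

variable {E : Type*} [AddCommGroup E] [Module ℝ E] {d : ℕ}
variable {v : Fin d → E} {co : E →ᵃ[ℝ] (Fin d → ℝ)} {Γ : SimplicialComplex ℝ E}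

/-! ### The coefficients of the local `h`-polynomial in degrees one and two -/

theorem coeff_one_sub_X_pow_one (m : ℕ) :
    ((1 - Polynomial.X : Polynomial ℤ) ^ m).coeff 1 = -m := by
  induction m with
  | zero => simp [Polynomial.coeff_one]
  | succ m ih =>
    rw [pow_succ, mul_sub, mul_one, Polynomial.coeff_sub, ih, Polynomial.coeff_mul_X,
      Polynomial.coeff_zero_eq_eval_zero]
    simp; ring

theorem coeff_one_sub_X_pow_two (m : ℕ) :
    ((1 - Polynomial.X : Polynomial ℤ) ^ m).coeff 2 = m.choose 2 := by
  induction m with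
  | zero => simp [Polynomial.coeff_one]
  | succ m ih =>
    rw [pow_succ, mul_sub, mul_one, Polynomial.coeff_sub, ih, Polynomial.coeff_mul_X,
      coeff_one_sub_X_pow_one, Nat.choose_succ_succ' m 1]
    simp; ring

theorem coeff_hPoly_one (K : SimplicialComplex ℝ E) (n : ℕ) (h0 : n = 0 → faceCount K 1 = 0) :
    (hPoly K n).coeff 1 = faceCount K 1 - n := by
  rcases n with _ | n
  · simp [hPoly, h0 rfl]
  · rw [hPoly, Polynomial.finsetSum_coeff, ← Finset.sum_subset
      (Finset.range_subset_range.2 (show 2 ≤ n + 1 + 1 by omega))]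
    · simp only [Finset.sum_range_succ, Finset.sum_range_zero, mul_assoc, Polynomial.coeff_C_mul,
        Polynomial.coeff_X_pow_mul', Nat.sub_zero, Nat.reduceSub,
        coeff_one_sub_X_pow_one]
      simp [Polynomial.coeff_zero_eq_eval_zero, faceCount]
      ring
    · intro i _ hi
      rw [mul_assoc, Polynomial.coeff_C_mul, Polynomial.coeff_X_pow_mul', if_neg, mul_zero]
      simpa using hi

/-- The hypotheses cover small `n`, where the sum defining `hPoly` stops before the terms with $f_0$
or $f_1$. -/
theorem coeff_hPoly_two (K : SimplicialComplex ℝ E) (n : ℕ) (h0 : n = 0 → faceCount K 1 = 0)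
    (h1 : n ≤ 1 → faceCount K 2 = 0) :
    (hPoly K n).coeff 2 = faceCount K 2 - (n - 1) * faceCount K 1 + n.choose 2 := by
  rcases n with _ | _ | n
  · have h0' := h0 rfl
    have h1' := h1 (by omega)
    simp [hPoly, h0', h1']
  · have h1' := h1 (by omega)
    simp [hPoly, Polynomial.coeff_one, h1', Finset.sum_range_succ, Polynomial.coeff_X]
  · rw [hPoly, Polynomial.finsetSum_coeff, ← Finset.sum_subset
      (Finset.range_subset_range.2 (show 3 ≤ n + 2 + 1 by omega))]
    · simp only [Finset.sum_range_succ, Finset.sum_range_zero, mul_assoc, Polynomial.coeff_C_mul,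
        Polynomial.coeff_X_pow_mul', Nat.sub_zero, Nat.reduceSub,
        coeff_one_sub_X_pow_one,
        coeff_one_sub_X_pow_two]
      simp [Polynomial.coeff_zero_eq_eval_zero, faceCount]
      ring
    · intro i _ hi
      rw [mul_assoc, Polynomial.coeff_C_mul, Polynomial.coeff_X_pow_mul', if_neg, mul_zero]
      simp only [Finset.mem_range] at hi; omega

/-- Passing to complements turns this into the alternating sum over all subsets of the complement of
`σ`. -/
theorem sum_sign_subset (σ : Finset (Fin d)) :
    ∑ F : Finset (Fin d), (-1 : ℤ) ^ (d - F.card) * (if σ ⊆ F then 1 else 0) =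
      if σ = Finset.univ then 1 else 0 := by
  rw [← (compl_involutive (α := Finset (Fin d))).bijective.sum_comp]
  have h : ∀ A : Finset (Fin d), (-1 : ℤ) ^ (d - (Aᶜ).card) * (if σ ⊆ Aᶜ then 1 else 0) =
      if A ∈ σᶜ.powerset then (-1) ^ A.card else 0 := by
    intro A
    have hA : A.card ≤ d := by simpa using A.card_le_univ
    rw [Finset.card_compl, Fintype.card_fin, Nat.sub_sub_self hA]
    have : σ ⊆ Aᶜ ↔ A ⊆ σᶜ := le_compl_comm
    simp [this]
  simp only [h]
  rw [Finset.sum_ite_mem, Finset.univ_inter, Finset.sum_powerset_neg_one_pow_card]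
  simp [Finset.compl_eq_empty_iff]

theorem choose_card_eq_sum (F : Finset (Fin d)) (k : ℕ) :
    (F.card.choose k : ℤ) = ∑ e ∈ Finset.powersetCard k (Finset.univ : Finset (Fin d)),
      if e ⊆ F then 1 else 0 := by
  rw [← Finset.card_powersetCard, Finset.sum_boole]
  congr 2
  ext e
  simp [Finset.mem_powersetCard, and_comm]

theorem sum_sign_choose {k : ℕ} (hk : k < d) :
    ∑ F : Finset (Fin d), (-1 : ℤ) ^ (d - F.card) * (F.card.choose k : ℤ) = 0 := by
  simp only [choose_card_eq_sum, Finset.mul_sum]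
  rw [Finset.sum_comm]
  refine Finset.sum_eq_zero fun e he => ?_
  rw [sum_sign_subset, if_neg]
  rintro rfl
  rw [Finset.mem_powersetCard] at he
  simp at he
  omega

theorem sum_sign_card_subset {σ : Finset (Fin d)} (hσ : σ ≠ Finset.univ) :
    ∑ F : Finset (Fin d), (-1 : ℤ) ^ (d - F.card) * (F.card * if σ ⊆ F then 1 else 0) =
      if σ.card + 1 = d then 1 else 0 := by
  -- The sum counts elements of `F`; indices already in `σ` contribute the same indicator.
  have hF : ∀ F : Finset (Fin d), ((F.card : ℤ) * if σ ⊆ F then 1 else 0) =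
      ∑ j : Fin d, if insert j σ ⊆ F then 1 else 0 := by
    intro F
    by_cases h : σ ⊆ F <;> simp [Finset.insert_subset_iff, h]
  simp only [hF, Finset.mul_sum]
  rw [Finset.sum_comm]
  simp only [sum_sign_subset]
  rw [Finset.sum_boole]
  have hj : ∀ j, insert j σ = Finset.univ ↔ σᶜ = {j} := by
    intro j
    constructor
    · intro h
      have hjσ : j ∉ σ := fun hj => hσ (by rwa [Finset.insert_eq_self.2 hj] at h)
      ext i
      have : i ∈ insert j σ := h ▸ Finset.mem_univ i
      simp only [Finset.mem_compl, Finset.mem_singleton]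
      constructor
      · intro hi; exact (Finset.mem_insert.1 this).resolve_right hi
      · rintro rfl; exact hjσ
    · intro h
      ext i
      have := Finset.ext_iff.1 h i
      simp only [Finset.mem_compl, Finset.mem_singleton] at this
      simp only [Finset.mem_insert, Finset.mem_univ, iff_true]
      tauto
  simp only [hj]
  have hc : σᶜ.card = d - σ.card := by simp [Finset.card_compl]
  have hle : σ.card ≤ d := by simpa using σ.card_le_univ
  split_ifs with h
  · obtain ⟨j, hj⟩ := Finset.card_eq_one.1 (show σᶜ.card = 1 by omega)
    simp [hj, Finset.filter_eq]
  · rw [Finset.filter_false_of_mem]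
    · simp
    · intro j _ hj
      rw [hj] at hc
      simp at hc
      omega

/-- The faces of a triangulation with `k` vertices. -/
noncomputable def facesOfCard (hΓ : IsTriangulation v Γ) (k : ℕ) : Finset (Finset E) :=
  hΓ.finite_faces.toFinset.filter fun G => G.card = k

theorem mem_facesOfCard {hΓ : IsTriangulation v Γ} {k : ℕ} {G : Finset E} :
    G ∈ facesOfCard hΓ k ↔ G ∈ Γ.faces ∧ G.card = k := by
  simp [facesOfCard]

theorem faceCount_restrict (hΓ : IsTriangulation v Γ) (hco : IsCoord v co) {k : ℕ} (hk : k ≠ 0)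
    (F : Finset (Fin d)) :
    (faceCount (restrict v Γ F) k : ℤ) = ∑ G ∈ facesOfCard hΓ k, if carrier v G ⊆ F then 1 else 0 := by
  rw [faceCount, if_neg hk, Finset.sum_boole, ← Set.ncard_coe_finset]
  congr 2
  ext G
  simp only [restrict, Set.mem_ofPred_eq, Finset.coe_filter, mem_facesOfCard]
  constructor
  · rintro ⟨⟨hG, hF⟩, hc⟩
    exact ⟨⟨hG, hc⟩, (hΓ.carrier_subset_iff hco hG).1 hF⟩
  · rintro ⟨⟨hG, hc⟩, hF⟩
    exact ⟨⟨hG, (hΓ.carrier_subset_iff hco hG).2 hF⟩, hc⟩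

theorem card_le_card_of_convexHull_subset {F : Finset (Fin d)} {G : Finset E} (hF : F.card ≤ 1)
    (hG : convexHull ℝ (G : Set E) ⊆ simplexFace v F) : G.card ≤ F.card := by
  have hsub : (v '' (F : Set (Fin d))).Subsingleton := by
    rintro _ ⟨i, hi, rfl⟩ _ ⟨j, hj, rfl⟩
    rw [Finset.card_le_one.1 hF i hi j hj]
  have h := (subset_convexHull ℝ (G : Set E)).trans hG
  rw [simplexFace, hsub.convex.convexHull_eq] at h
  have := (Set.ncard_le_ncard h (F.finite_toSet.image v)).trans (Set.ncard_image_le F.finite_toSet)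
  simpa using this

theorem faceCount_restrict_eq_zero (Γ : SimplicialComplex ℝ E) {k : ℕ} {F : Finset (Fin d)}
    (hF : F.card ≤ 1) (hk : F.card < k) : faceCount (restrict v Γ F) k = 0 := by
  rw [faceCount, if_neg (by omega)]
  have : {G : Finset E | G ∈ (restrict v Γ F).faces ∧ G.card = k} = ∅ := by
    ext G
    simp only [Set.mem_ofPred_eq, Set.mem_empty_iff_false, iff_false]
    rintro ⟨⟨-, hG⟩, hc⟩
    have := card_le_card_of_convexHull_subset hF hG
    omega
  rw [this, Set.ncard_empty]

theorem coeff_localH (Γ : SimplicialComplex ℝ E) (k : ℕ) :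
    (localH v Γ).coeff k =
      ∑ F : Finset (Fin d), (-1 : ℤ) ^ (d - F.card) * (hPoly (restrict v Γ F) F.card).coeff k := by
  simp only [localH, localHFace, Polynomial.finsetSum_coeff, Finset.powerset_univ,
    Finset.card_univ, Fintype.card_fin]
  refine Finset.sum_congr rfl fun F _ => ?_
  rw [show (-1 : Polynomial ℤ) = Polynomial.C (-1) by simp, ← Polynomial.C_pow,
    Polynomial.coeff_C_mul]

theorem coeff_localH_one (hd : 2 ≤ d) (hΓ : IsTriangulation v Γ) (hco : IsCoord v co) :
    (localH v Γ).coeff 1 =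
      ((facesOfCard hΓ 1).filter fun G => carrier v G = Finset.univ).card := by
  have h : ∀ F : Finset (Fin d), (hPoly (restrict v Γ F) F.card).coeff 1 =
      (∑ G ∈ facesOfCard hΓ 1, if carrier v G ⊆ F then 1 else 0) - F.card.choose 1 := by
    intro F
    rw [coeff_hPoly_one _ _ fun h => faceCount_restrict_eq_zero Γ (by omega) (by omega),
      faceCount_restrict hΓ hco one_ne_zero, Nat.choose_one_right]
  simp only [coeff_localH, h, mul_sub, Finset.sum_sub_distrib]
  rw [sum_sign_choose (by omega)]
  simp only [Finset.mul_sum]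
  rw [Finset.sum_comm]
  simp only [sum_sign_subset]
  rw [Finset.sum_boole, sub_zero]

/-- Here $h_2(\Gamma_F)=f_1-|F|f_0+f_0+\binom{|F|}2$. The signed sums pick out internal edges, facet
vertices, interior vertices (none, by `hint`) and zero (as $2<d$). -/
theorem coeff_localH_two (hd : 3 ≤ d) (hΓ : IsTriangulation v Γ) (hco : IsCoord v co)
    (hint : ∀ G ∈ facesOfCard hΓ 1, carrier v G ≠ Finset.univ) :
    (localH v Γ).coeff 2 =
      ((facesOfCard hΓ 2).filter fun G => carrier v G = Finset.univ).card -
        ((facesOfCard hΓ 1).filter fun G => (carrier v G).card + 1 = d).card := by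
  have h : ∀ F : Finset (Fin d), (hPoly (restrict v Γ F) F.card).coeff 2 =
      (∑ G ∈ facesOfCard hΓ 2, if carrier v G ⊆ F then 1 else 0) -
        (∑ G ∈ facesOfCard hΓ 1, (F.card : ℤ) * if carrier v G ⊆ F then 1 else 0) +
        (∑ G ∈ facesOfCard hΓ 1, if carrier v G ⊆ F then 1 else 0) + F.card.choose 2 := by
    intro F
    rw [coeff_hPoly_two _ _ (fun h => faceCount_restrict_eq_zero Γ (by omega) (by omega))
      (fun h => faceCount_restrict_eq_zero Γ h (by omega)),
      faceCount_restrict hΓ hco one_ne_zero, faceCount_restrict hΓ hco two_ne_zero,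
      ← Finset.mul_sum]
    ring
  simp only [coeff_localH, h, mul_sub, mul_add, Finset.sum_sub_distrib, Finset.sum_add_distrib]
  rw [sum_sign_choose (by omega)]
  simp only [Finset.mul_sum]
  rw [Finset.sum_comm, Finset.sum_comm (t := facesOfCard hΓ 1),
    Finset.sum_comm (t := facesOfCard hΓ 1)]
  simp only [sum_sign_subset]
  rw [Finset.sum_congr rfl fun G hG => sum_sign_card_subset (hint G hG),
    Finset.sum_congr (s₁ := facesOfCard hΓ 1) (g := fun _ => (0 : ℤ)) rfl
      fun G hG => if_neg (hint G hG)]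
  rw [Finset.sum_boole, Finset.sum_boole, Finset.sum_const_zero]
  ring

end LocalH

/-! ### Graphs with few edges -/

namespace SimpleGraph

variable {V : Type*} {G : SimpleGraph V}

/-- Deleting an edge of `p` that is not in `q` keeps the graph connected and leaves at most $|V|-1$
edges, hence a tree, which cannot contain `q`. -/
theorem Connected.mem_edges_of_isCycle [Finite V] (hG : G.Connected)
    (hcard : Nat.card G.edgeSet ≤ Nat.card V) {u w : V} {p : G.Walk u u} {q : G.Walk w w}
    (hp : p.IsCycle) (hq : q.IsCycle) {e : Sym2 V} (he : e ∈ p.edges) : e ∈ q.edges := by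
  by_contra hne
  have heG : e ∈ G.edgeSet := p.edges_subset_edgeSet he
  induction e using Sym2.ind with | _ x y
  have hbr : ¬ G.IsBridge s(x, y) := fun h =>
    (isBridge_iff_forall_cycle_notMem heG).1 h p hp he
  have hconn := hG.connected_delete_edge_of_not_isBridge hbr
  have hc : Nat.card (G.deleteEdges {s(x, y)}).edgeSet + 1 = Nat.card V := by
    refine le_antisymm ?_ hconn.card_vert_le_card_edgeSet_add_one
    rw [edgeSet_deleteEdges, Nat.card_coe_set_eq,
      Set.ncard_sdiff_singleton_add_one heG (Set.toFinite _), ← Nat.card_coe_set_eq]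
    exact hcard
  have htree := isTree_iff_connected_and_card.2 ⟨hconn, hc⟩
  have hsub : ∀ e' ∈ q.edges, e' ∈ (G.deleteEdges {s(x, y)}).edgeSet := fun e' he' => by
    rw [edgeSet_deleteEdges]
    exact ⟨q.edges_subset_edgeSet he', fun h => hne (Set.mem_singleton_iff.1 h ▸ he')⟩
  exact htree.isAcyclic _ (hq.transfer hsub)

theorem Connected.toSubgraph_eq_of_isCycle [Finite V] (hG : G.Connected)
    (hcard : Nat.card G.edgeSet ≤ Nat.card V) {u w : V} {p : G.Walk u u} {q : G.Walk w w}
    (hp : p.IsCycle) (hq : q.IsCycle) : p.toSubgraph = q.toSubgraph := by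
  have h : ∀ e, e ∈ p.edges ↔ e ∈ q.edges := fun e =>
    ⟨hG.mem_edges_of_isCycle hcard hp hq, hG.mem_edges_of_isCycle hcard hq hp⟩
  ext x y
  · rw [Walk.mem_verts_toSubgraph, Walk.mem_verts_toSubgraph,
      Walk.mem_support_iff_exists_mem_edges_of_not_nil hp.not_nil,
      Walk.mem_support_iff_exists_mem_edges_of_not_nil hq.not_nil]
    simp only [h]
  · rw [Walk.adj_toSubgraph_iff_mem_edges, Walk.adj_toSubgraph_iff_mem_edges, h]

theorem exists_isCycle_of_triangle {x y z : V} (hxy : G.Adj x y) (hyz : G.Adj y z)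
    (hzx : G.Adj z x) : ∃ p : G.Walk x x, p.IsCycle ∧ p.length = 3 ∧ p.support = [x, y, z, x] := by
  refine ⟨.cons hxy (.cons hyz (.cons hzx .nil)), ?_, rfl, rfl⟩
  have h1 := hxy.ne
  have h2 := hyz.ne
  have h3 := hzx.ne
  rw [Walk.cons_isCycle_iff]
  simp [Walk.isPath_def, h1, h2, h3, h1.symm, h3.symm]

theorem sum_card_edgeSet_toSimpleGraph_le [Finite V] [Fintype G.ConnectedComponent] :
    ∑ C : G.ConnectedComponent, Nat.card C.toSimpleGraph.edgeSet ≤ Nat.card G.edgeSet := by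
  rw [← Nat.card_sigma]
  refine Nat.card_le_card_of_injective
    (fun x : Σ C : G.ConnectedComponent, C.toSimpleGraph.edgeSet =>
      x.1.toSimpleGraph_hom.mapEdgeSet x.2) ?_
  rintro ⟨C, e, he⟩ ⟨C', e', he'⟩ h
  have h' : Sym2.map (fun x : C => (x : V)) e = Sym2.map (fun x : C' => (x : V)) e' :=
    congrArg Subtype.val h
  have hC : C = C' := by
    induction e using Sym2.ind with | _ x y
    induction e' using Sym2.ind with | _ x' y'
    have hx : (x : V) ∈ Sym2.map (fun x : C' => (x : V)) s(x', y') := by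
      rw [← h']; simp
    obtain ⟨z, -, hz⟩ := Sym2.mem_map.1 hx
    have h1 : G.connectedComponentMk x = C := x.2
    have h2 : G.connectedComponentMk z = C' := z.2
    rw [← h1, ← h2, hz]
  subst hC
  have := Sym2.map.injective Subtype.val_injective h'
  subst this
  rfl

/-- If a finite graph has as many edges as there are vertices in `W`, and every component has a
vertex outside of `W`, then every component is a tree with exactly one such vertex. -/
theorem isTree_of_card_edgeSet_eq [Finite V] {W : Set V} (hcard : Nat.card G.edgeSet = W.ncard)
    (hW : ∀ C : G.ConnectedComponent, ∃ w ∈ C.supp, w ∉ W) (C : G.ConnectedComponent) :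
    C.toSimpleGraph.IsTree ∧ ∃! w, w ∈ C.supp ∧ w ∉ W := by
  classical
  have : Fintype V := Fintype.ofFinite V
  have : Fintype G.ConnectedComponent := Fintype.ofFinite _
  have hn : ∀ C : G.ConnectedComponent,
      Nat.card C = (C.supp ∩ W).ncard + (C.supp \ W).ncard := fun C => by
    rw [Set.ncard_inter_add_ncard_sdiff_eq_ncard _ _ (Set.toFinite _)]
    exact Nat.card_coe_set_eq _
  have hle : ∀ C : G.ConnectedComponent, Nat.card C ≤ Nat.card C.toSimpleGraph.edgeSet + 1 :=
    fun C => C.connected_toSimpleGraph.card_vert_le_card_edgeSet_add_one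
  have hb : ∀ C : G.ConnectedComponent, 1 ≤ (C.supp \ W).ncard := fun C => by
    obtain ⟨w, hw, hwW⟩ := hW C
    exact (Set.ncard_pos (Set.toFinite _)).2 ⟨w, hw, hwW⟩
  have hsum : W.ncard = ∑ C : G.ConnectedComponent, (C.supp ∩ W).ncard := by
    rw [Set.ncard_eq_toFinset_card', Finset.card_eq_sum_card_fiberwise
      (f := G.connectedComponentMk) (t := Finset.univ) (fun _ _ => Finset.mem_univ _)]
    refine Finset.sum_congr rfl fun C _ => ?_
    rw [← Set.ncard_coe_finset]
    congr 1
    ext w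
    simp [and_comm]
  -- Termwise $|C\cap W|\le|C|-1\le e(C)$, while the totals force equality.
  have heq : ∀ C ∈ (Finset.univ : Finset G.ConnectedComponent), (C.supp ∩ W).ncard = Nat.card C.toSimpleGraph.edgeSet := by
    refine (Finset.sum_eq_sum_iff_of_le fun C _ => ?_).1
      (le_antisymm (Finset.sum_le_sum fun C _ => ?_) ?_)
    · have := hn C; have := hle C; have := hb C; omega
    · have := hn C; have := hle C; have := hb C; omega
    · rw [← hsum, ← hcard]
      exact sum_card_edgeSet_toSimpleGraph_le
  have h1 := hn C
  have h2 := hle C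
  have h3 := hb C
  have h4 := heq C (Finset.mem_univ _)
  refine ⟨isTree_iff_connected_and_card.2 ⟨C.connected_toSimpleGraph, by omega⟩, ?_⟩
  obtain ⟨w, hw⟩ := Set.ncard_eq_one.1 (show (C.supp \ W).ncard = 1 by omega)
  refine ⟨w, ?_, fun z hz => ?_⟩
  · exact (hw ▸ Set.mem_singleton w : w ∈ C.supp \ W)
  · exact (hw ▸ hz : z ∈ ({w} : Set V))

end SimpleGraph

namespace LocalH

open Geometry Filter Topology

variable {E : Type*} [AddCommGroup E] [Module ℝ E] {d : ℕ}
variable {v : Fin d → E} {co : E →ᵃ[ℝ] (Fin d → ℝ)} {Γ : SimplicialComplex ℝ E}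

/-! ### The internal edge graph -/

theorem mem_carrier_singleton (hΓ : IsTriangulation v Γ) (hco : IsCoord v co) {w : E}
    (hw : {w} ∈ Γ.faces) {i : Fin d} : i ∈ carrier v {w} ↔ co w i ≠ 0 := by
  simp [hΓ.mem_carrier_iff hco hw]

theorem excess_singleton (v : Fin d → E) (w : E) :
    excess v {w} = ((carrier v {w}).card : ℤ) - 1 := by
  simp [excess, simplexDim]

theorem exists_coord_eq_zero_iff (hΓ : IsTriangulation v Γ) (hco : IsCoord v co) {w : E}
    (hw : {w} ∈ Γ.faces) (hcard : (carrier v {w}).card + 1 = d) :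
    ∃ l, ∀ j, co w j = 0 ↔ j = l := by
  have hc : (carrier v {w})ᶜ.card = 1 := by
    rw [Finset.card_compl, Fintype.card_fin]; omega
  obtain ⟨l, hl⟩ := Finset.card_eq_one.1 hc
  refine ⟨l, fun j => ?_⟩
  have := Finset.ext_iff.1 hl j
  rwa [Finset.mem_compl, mem_carrier_singleton hΓ hco hw, not_not, Finset.mem_singleton] at this

theorem internalEdges_adj_of_mem_face (hΓ : IsTriangulation v Γ) (hco : IsCoord v co)
    {G : Finset E} (hG : G ∈ Γ.faces) {a b : E} (ha : a ∈ G) (hb : b ∈ G) (hab : a ≠ b)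
    (h : ∀ i, co a i ≠ 0 ∨ co b i ≠ 0) : (internalEdges v Γ).Adj a b := by
  classical
  have hf : ({a, b} : Finset E) ∈ Γ.faces :=
    Γ.down_closed hG (by simp [Finset.insert_subset_iff, ha, hb]) (by simp)
  refine ⟨hab, by convert hf, ?_⟩
  ext i
  simp only [Finset.mem_univ, iff_true]
  convert (hΓ.mem_carrier_iff hco hf).2 ?_
  simpa using h i

theorem internalEdges_adj_spec (hΓ : IsTriangulation v Γ) (hco : IsCoord v co) {a b : E}
    (h : (internalEdges v Γ).Adj a b) : ∃ G ∈ Γ.faces, a ∈ G ∧ b ∈ G ∧ (∀ x ∈ G, x = a ∨ x = b) ∧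
      ∀ i, co a i ≠ 0 ∨ co b i ≠ 0 := by
  classical
  obtain ⟨-, hf, hc⟩ := h
  refine ⟨_, hf, by simp, by simp, by simp, fun i => ?_⟩
  have := (hΓ.mem_carrier_iff hco hf (i := i)).1 (hc ▸ Finset.mem_univ i)
  simpa using this

theorem singleton_mem_faces_of_mem {G : Finset E} (hG : G ∈ Γ.faces) {a : E} (ha : a ∈ G) :
    {a} ∈ Γ.faces :=
  Γ.down_closed hG (by simpa using ha) (by simp)

theorem singleton_mem_faces_of_mem_support (hΓ : IsTriangulation v Γ) (hco : IsCoord v co) {a : E}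
    (ha : a ∈ (internalEdges v Γ).support) : {a} ∈ Γ.faces := by
  obtain ⟨b, hab⟩ := ha
  obtain ⟨G, hG, haG, -⟩ := internalEdges_adj_spec hΓ hco hab
  exact singleton_mem_faces_of_mem hG haG

theorem finite_support (hΓ : IsTriangulation v Γ) (hco : IsCoord v co) :
    (internalEdges v Γ).support.Finite :=
  (hΓ.finite_faces.preimage (Finset.singleton_injective.injOn)).subset
    fun _ ha => singleton_mem_faces_of_mem_support hΓ hco ha

/-- Every vertex in the relative interior of a facet is incident to an internal edge. -/
theorem mem_support_of_facet [NeZero d] (hΓ : IsTriangulation v Γ) (hco : IsCoord v co) {w : E}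
    (hw : {w} ∈ Γ.faces) {l : Fin d} (hl : ∀ j, co w j = 0 ↔ j = l) :
    w ∈ (internalEdges v Γ).support := by
  obtain ⟨hS, hsub⟩ := hΓ.faceAt_subset hco hw (x := w) (subset_convexHull ℝ _ (by simp))
  obtain ⟨z, hz, hwz⟩ := exists_mem_openSimplex hS (eventually_faceAt_subset hΓ hS hco)
  have hwmem : w ∈ faceAt v Γ (co w) := by
    obtain ⟨x, hx⟩ := Γ.nonempty_of_mem_faces (faceAt_mem_faces hΓ hS)
    exact Finset.mem_singleton.1 (hsub hx) ▸ hx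
  obtain ⟨w', hw', h'⟩ := exists_mem_faceAt_coord_ne_zero hΓ hz.1 hco (hz.2 l).ne'
  refine ⟨w', internalEdges_adj_of_mem_face hΓ hco (faceAt_mem_faces hΓ hz.1) (hwz hwmem) hw'
    ?_ fun i => ?_⟩
  · rintro rfl
    exact h' ((hl l).2 rfl)
  · by_cases hi : i = l
    · exact Or.inr (hi ▸ h')
    · exact Or.inl fun h => hi ((hl i).1 h)

theorem card_edgeSet_internalEdgeGraph (hΓ : IsTriangulation v Γ) :
    Nat.card (internalEdgeGraph v Γ).edgeSet =
      ((facesOfCard hΓ 2).filter fun G => carrier v G = Finset.univ).card := by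
  classical
  let f : Sym2 (internalEdges v Γ).support → Finset E := fun e => (Sym2.map Subtype.val e).toFinset
  have hf : Function.Injective f := by
    intro e e' h
    refine Sym2.map.injective Subtype.val_injective (Sym2.ext fun x => ?_)
    rw [← Sym2.mem_toFinset, ← Sym2.mem_toFinset]
    exact Finset.ext_iff.1 h x
  have hmk : ∀ x y, f s(x, y) = {(x : E), (y : E)} := by
    intro x y
    ext z
    simp [f]
  rw [Nat.card_coe_set_eq, ← Set.ncard_image_of_injective _ hf, ← Set.ncard_coe_finset]
  congr 1
  ext G
  simp only [Set.mem_image, Finset.coe_filter, Set.mem_ofPred_eq, mem_facesOfCard]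
  constructor
  · rintro ⟨e, he, rfl⟩
    induction e using Sym2.ind with | _ x y
    have hadj : (internalEdges v Γ).Adj x y := he
    obtain ⟨hne, hface, hcar⟩ := hadj
    rw [hmk]
    exact ⟨⟨by convert hface, Finset.card_pair hne⟩, by convert hcar⟩
  · rintro ⟨⟨hG, hcard⟩, hcar⟩
    obtain ⟨a, b, hab, rfl⟩ := Finset.card_eq_two.1 hcard
    have hadj : (internalEdges v Γ).Adj a b := ⟨hab, by convert hG, by convert hcar⟩
    exact ⟨s(⟨a, b, hadj⟩, ⟨b, a, hadj.symm⟩), hadj, hmk _ _⟩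

theorem ncard_facet_vertices [NeZero d] (hΓ : IsTriangulation v Γ) (hco : IsCoord v co) :
    {w : (internalEdges v Γ).support | (carrier v {(w : E)}).card + 1 = d}.ncard =
      ((facesOfCard hΓ 1).filter fun G => (carrier v G).card + 1 = d).card := by
  have hf : Function.Injective fun w : (internalEdges v Γ).support => ({(w : E)} : Finset E) :=
    Finset.singleton_injective.comp Subtype.val_injective
  rw [← Set.ncard_image_of_injective _ hf, ← Set.ncard_coe_finset]
  congr 1
  ext G
  simp only [Set.mem_image, Finset.coe_filter, Set.mem_ofPred_eq, mem_facesOfCard]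
  constructor
  · rintro ⟨w, hw, rfl⟩
    exact ⟨⟨singleton_mem_faces_of_mem_support hΓ hco w.2, Finset.card_singleton _⟩, hw⟩
  · rintro ⟨⟨hG, hcard⟩, hcar⟩
    obtain ⟨w, rfl⟩ := Finset.card_eq_one.1 hcard
    obtain ⟨l, hl⟩ := exists_coord_eq_zero_iff hΓ hco hG hcar
    exact ⟨⟨w, mem_support_of_facet hΓ hco hG hl⟩, hcar, rfl⟩

/-- A component of the internal edge graph all of whose vertices lie in relative interiors of
facets is an `IsFacetFamily`. -/
theorem exists_isFacetFamily (hΓ : IsTriangulation v Γ) (hco : IsCoord v co)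
    {C : (internalEdgeGraph v Γ).ConnectedComponent}
    (hC : ∀ w ∈ C.supp, (carrier v {(w : E)}).card + 1 = d) :
    ∃ col : E → Fin d, IsFacetFamily co Γ (Subtype.val '' C.supp) col := by
  have h : ∀ w : E, ∃ l : Fin d, w ∈ Subtype.val '' C.supp → ∀ j, co w j = 0 ↔ j = l := by
    intro w
    by_cases hw : w ∈ Subtype.val '' C.supp
    · obtain ⟨x, hx, rfl⟩ := hw
      obtain ⟨l, hl⟩ := exists_coord_eq_zero_iff hΓ hco
        (singleton_mem_faces_of_mem_support hΓ hco x.2) (hC x hx)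
      exact ⟨l, fun _ => hl⟩
    · obtain ⟨x, hx⟩ := C.nonempty_supp
      have hd : 0 < d := by have := hC x hx; omega
      exact ⟨⟨0, hd⟩, fun h => absurd h hw⟩
  choose col hcol using h
  refine ⟨col, hcol, ?_⟩
  rintro G hG w hwG hw w' hwG' h'
  have hzero := hcol w hw
  have hadj : (internalEdges v Γ).Adj w w' := by
    refine internalEdges_adj_of_mem_face hΓ hco hG hwG hwG' ?_ fun i => ?_
    · rintro rfl
      exact h' ((hzero _).2 rfl)
    · by_cases hi : i = col w
      · exact Or.inr (hi ▸ h')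
      · exact Or.inl fun h => hi ((hzero i).1 h)
  obtain ⟨x, hx, rfl⟩ := hw
  have hadj' : (internalEdgeGraph v Γ).Adj x ⟨w', x, hadj.symm⟩ := hadj
  exact ⟨⟨w', x, hadj.symm⟩, (C.mem_supp_congr_adj hadj').1 hx, rfl⟩

/-- The midpoint of an internal edge is interior, as no coordinate vanishes at both ends. -/
theorem exists_faceAt_subset_of_adj (hΓ : IsTriangulation v Γ) (hco : IsCoord v co) {a b : E}
    (h : (internalEdges v Γ).Adj a b) : ∃ y ∈ openSimplex d, faceAt v Γ y ∈ Γ.faces ∧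
      ∀ x ∈ faceAt v Γ y, x = a ∨ x = b := by
  obtain ⟨G, hG, ha, hb, hab, hi⟩ := internalEdges_adj_spec hΓ hco h
  obtain ⟨hS, hsub⟩ := hΓ.faceAt_subset hco hG (x := midpoint ℝ a b)
    ((convex_convexHull ℝ _).midpoint_mem (subset_convexHull ℝ _ ha) (subset_convexHull ℝ _ hb))
  refine ⟨_, ⟨hS, fun i => ?_⟩, faceAt_mem_faces hΓ hS, fun x hx => hab x (hsub hx)⟩
  rw [coord_midpoint]
  have h1 := hΓ.coord_nonneg hco hG ha i
  have h2 := hΓ.coord_nonneg hco hG hb i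
  rcases hi i with h | h
  · have := h1.lt_of_ne' h; linarith
  · have := h2.lt_of_ne' h; linarith

/-- If all vertices of a component lie in relative interiors of facets, then every interior point
of the simplex lies in a smallest face that meets the component. -/
theorem exists_hasColor_component (hΓ : IsTriangulation v Γ) (hco : IsCoord v co)
    {C : (internalEdgeGraph v Γ).ConnectedComponent} {col : E → Fin d}
    (hD : IsFacetFamily co Γ (Subtype.val '' C.supp) col) {y : Fin d → ℝ}
    (hy : y ∈ openSimplex d) : ∃ l, HasColor v Γ (Subtype.val '' C.supp) col y l := by
  obtain ⟨x, hx⟩ := C.nonempty_supp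
  obtain ⟨b, hb⟩ := x.2
  have hb : (internalEdges v Γ).Adj x b := hb
  have hadj : (internalEdgeGraph v Γ).Adj x ⟨b, x, hb.symm⟩ := hb
  obtain ⟨z, hz, hface, hsub⟩ := exists_faceAt_subset_of_adj hΓ hco hb
  obtain ⟨w, hw⟩ := Γ.nonempty_of_mem_faces hface
  refine hD.exists_hasColor hΓ hco hz hy ⟨col w, w, hw, ?_, rfl⟩
  rcases hsub w hw with rfl | rfl
  · exact ⟨x, hx, rfl⟩
  · exact ⟨_, (C.mem_supp_congr_adj hadj).1 hx, rfl⟩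

/-- The smallest face at the midpoint of an internal edge at `x` meets `C`, and its vertices are
among the two ends of that edge. -/
theorem component_eq_of_isFacetFamily (hΓ : IsTriangulation v Γ) (hco : IsCoord v co)
    {C : (internalEdgeGraph v Γ).ConnectedComponent} {col : E → Fin d}
    (hD : IsFacetFamily co Γ (Subtype.val '' C.supp) col) (x : (internalEdges v Γ).support) :
    x ∈ C.supp := by
  obtain ⟨b, hb⟩ := x.2
  have hb : (internalEdges v Γ).Adj x b := hb
  have hadj : (internalEdgeGraph v Γ).Adj x ⟨b, x, hb.symm⟩ := hb
  obtain ⟨z, hz, -, hsub⟩ := exists_faceAt_subset_of_adj hΓ hco hb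
  obtain ⟨-, w, hw, ⟨u, hu, rfl⟩, -⟩ := exists_hasColor_component hΓ hco hD hz
  rcases hsub u hw with h | h
  · rwa [← Subtype.ext h]
  · rw [C.mem_supp_congr_adj hadj]
    rwa [show u = ⟨b, x, hb.symm⟩ from Subtype.ext h] at hu

/-- A component with all vertices in relative interiors of facets contains triangles that have a
vertex of any given color. -/
theorem exists_triangle (hd : 3 ≤ d) (hΓ : IsTriangulation v Γ) (hco : IsCoord v co)
    {C : (internalEdgeGraph v Γ).ConnectedComponent} {col : E → Fin d}
    (hD : IsFacetFamily co Γ (Subtype.val '' C.supp) col) (l : Fin d) :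
    ∃ x y z : C, C.toSimpleGraph.Adj x y ∧ C.toSimpleGraph.Adj y z ∧ C.toSimpleGraph.Adj z x ∧
      col x.1 = l := by
  obtain ⟨G, hG, a, ha, b, hb, c, hc, haD, hbD, hcD, hal, hbl, hcl, hbc⟩ :=
    hD.exists_three_colors hd hΓ hco (fun y hy => exists_hasColor_component hΓ hco hD hy) l
  have hadj : ∀ a ∈ G, ∀ b ∈ G, a ∈ Subtype.val '' C.supp → b ∈ Subtype.val '' C.supp →
      col a ≠ col b → (internalEdges v Γ).Adj a b := by
    intro a ha b hb haD hbD hne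
    refine internalEdges_adj_of_mem_face hΓ hco hG ha hb (fun h => hne (h ▸ rfl)) fun i => ?_
    by_contra! h
    exact hne (((hD.coord_eq_zero_iff a haD i).1 h.1).symm.trans
      ((hD.coord_eq_zero_iff b hbD i).1 h.2))
  have h1 := hadj a ha b hb haD hbD (hal.trans_ne hbl.symm)
  have h2 := hadj b hb c hc hbD hcD hbc
  have h3 := hadj c hc a ha hcD haD (hal.symm ▸ hcl)
  obtain ⟨a, haC, rfl⟩ := haD
  obtain ⟨b, hbC, rfl⟩ := hbD
  obtain ⟨c, hcC, rfl⟩ := hcD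
  exact ⟨⟨a, haC⟩, ⟨b, hbC⟩, ⟨c, hcC⟩, h1, h2, h3, hal⟩

theorem eq_three_and_hasUniqueSimpleThreeCycle (hd : 3 ≤ d) (hΓ : IsTriangulation v Γ)
    (hco : IsCoord v co) {C : (internalEdgeGraph v Γ).ConnectedComponent} {col : E → Fin d}
    (hD : IsFacetFamily co Γ (Subtype.val '' C.supp) col)
    (hcard : Nat.card C.toSimpleGraph.edgeSet ≤ Nat.card C) :
    d = 3 ∧ HasUniqueSimpleThreeCycle C.toSimpleGraph := by
  have : Finite (internalEdges v Γ).support := finite_support hΓ hco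
  have huniq : ∀ {u w : C} {p : C.toSimpleGraph.Walk u u} {q : C.toSimpleGraph.Walk w w},
      p.IsCycle → q.IsCycle → p.toSubgraph = q.toSubgraph := fun hp hq =>
    C.connected_toSimpleGraph.toSubgraph_eq_of_isCycle hcard hp hq
  obtain ⟨x, y, z, hxy, hyz, hzx, -⟩ := exists_triangle hd hΓ hco hD ⟨0, by omega⟩
  obtain ⟨p, hp, hlen, hsupp⟩ := SimpleGraph.exists_isCycle_of_triangle hxy hyz hzx
  refine ⟨le_antisymm ?_ hd, p.toSubgraph, ⟨x, p, hp, hlen, rfl⟩, fun u q hq => huniq hq hp⟩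
  -- A triangle through color `l` must be the unique cycle `p`, so the three vertices of `p` show
  -- every color.
  have hsub : (Finset.univ : Finset (Fin d)) ⊆ {col x.1, col y.1, col z.1} := by
    intro l _
    obtain ⟨x', y', z', hxy', hyz', hzx', rfl⟩ := exists_triangle hd hΓ hco hD l
    obtain ⟨q, hq, -⟩ := SimpleGraph.exists_isCycle_of_triangle hxy' hyz' hzx'
    have hx' : x' ∈ p.support := by
      rw [← p.mem_verts_toSubgraph, huniq hp hq, q.mem_verts_toSubgraph]
      exact q.start_mem_support
    rw [hsupp] at hx'
    simp only [List.mem_cons, List.not_mem_nil, or_false] at hx'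
    rcases hx' with rfl | rfl | rfl | rfl <;> simp
  have h := (Finset.card_le_card hsub).trans Finset.card_le_three
  simpa using h

end LocalH

/-! ### Combining the edge count with the geometry -/

theorem theorem1p3 {E : Type*} [AddCommGroup E] [Module ℝ E] (d : ℕ) (hd : 3 ≤ d)
    (v : Fin d → E) (hv : AffineIndependent ℝ v)
    (Γ : Geometry.SimplicialComplex ℝ E) (hΓ : LocalH.IsTriangulation v Γ)
    (h1 : (LocalH.localH v Γ).coeff 1 = 0) (h2 : (LocalH.localH v Γ).coeff 2 = 0) :
    (∀ C : (LocalH.internalEdgeGraph v Γ).ConnectedComponent,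
      (C.toSimpleGraph.IsTree ∧ ∃! w, w ∈ C.supp ∧ LocalH.excess v {(w : E)} < (d : ℤ) - 2) ∨
      (d = 3 ∧ (∀ w ∈ C.supp, LocalH.excess v {(w : E)} = (d : ℤ) - 2) ∧
        LocalH.HasUniqueSimpleThreeCycle C.toSimpleGraph)) ∧
    (4 ≤ d → ∀ C : (LocalH.internalEdgeGraph v Γ).ConnectedComponent,
      C.toSimpleGraph.IsTree ∧
        ∃! w, w ∈ C.supp ∧
          2 ≤ ((d : ℤ) - 1) - LocalH.simplexDim (LocalH.carrier v {(w : E)})) := by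
  classical
  obtain ⟨co, hco⟩ := LocalH.exists_isCoord hv
  have : NeZero d := ⟨by omega⟩
  have : Finite (LocalH.internalEdges v Γ).support := LocalH.finite_support hΓ hco
  have hint : ∀ G ∈ LocalH.facesOfCard hΓ 1, LocalH.carrier v G ≠ Finset.univ := by
    rw [LocalH.coeff_localH_one (by omega) hΓ hco, Nat.cast_eq_zero, Finset.card_eq_zero] at h1
    exact Finset.filter_eq_empty_iff.1 h1
  rw [LocalH.coeff_localH_two hd hΓ hco hint, ← LocalH.card_edgeSet_internalEdgeGraph,
    ← LocalH.ncard_facet_vertices hΓ hco, sub_eq_zero, Nat.cast_inj] at h2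
  have hlt : ∀ w : (LocalH.internalEdges v Γ).support, (LocalH.carrier v {(w : E)}).card < d := by
    intro w
    have h := hint {(w : E)} (LocalH.mem_facesOfCard.2
      ⟨LocalH.singleton_mem_faces_of_mem_support hΓ hco w.2, Finset.card_singleton _⟩)
    simpa using (Finset.card_lt_iff_ne_univ _).2 h
  -- Without interior vertices the excess is at most $d-2$, with equality exactly for facet
  -- vertices.
  have hex : ∀ w : (LocalH.internalEdges v Γ).support,
      LocalH.excess v {(w : E)} < (d : ℤ) - 2 ↔ ¬ (LocalH.carrier v {(w : E)}).card + 1 = d := by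
    intro w
    have := hlt w
    rw [LocalH.excess_singleton]
    omega
  have hmain : ∀ C : (LocalH.internalEdgeGraph v Γ).ConnectedComponent,
      (C.toSimpleGraph.IsTree ∧ ∃! w, w ∈ C.supp ∧ LocalH.excess v {(w : E)} < (d : ℤ) - 2) ∨
      (d = 3 ∧ (∀ w ∈ C.supp, LocalH.excess v {(w : E)} = (d : ℤ) - 2) ∧
        LocalH.HasUniqueSimpleThreeCycle C.toSimpleGraph) := by
    intro C
    -- The split is over all components at once, since the edge count is only known globally.
    by_cases hW : ∀ C : (LocalH.internalEdgeGraph v Γ).ConnectedComponent, ∃ w ∈ C.supp,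
        w ∉ {w : (LocalH.internalEdges v Γ).support | (LocalH.carrier v {(w : E)}).card + 1 = d}
    · left
      simp only [hex]
      exact SimpleGraph.isTree_of_card_edgeSet_eq h2 hW C
    · right
      push Not at hW
      obtain ⟨C₀, hC₀⟩ := hW
      obtain ⟨col, hD⟩ := LocalH.exists_isFacetFamily hΓ hco hC₀
      have hall := LocalH.component_eq_of_isFacetFamily hΓ hco hD
      obtain rfl : C = C₀ := by
        obtain ⟨x, hx⟩ := C.nonempty_supp
        exact SimpleGraph.ConnectedComponent.eq_of_common_vertex hx (hall x)
      have hcard : Nat.card C.toSimpleGraph.edgeSet ≤ Nat.card C := by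
        have := Fintype.ofFinite (LocalH.internalEdgeGraph v Γ).ConnectedComponent
        calc Nat.card C.toSimpleGraph.edgeSet
            ≤ ∑ C : (LocalH.internalEdgeGraph v Γ).ConnectedComponent,
                Nat.card C.toSimpleGraph.edgeSet :=
              Finset.single_le_sum (f := fun C : (LocalH.internalEdgeGraph v Γ).ConnectedComponent =>
                Nat.card C.toSimpleGraph.edgeSet) (fun _ _ => Nat.zero_le _) (Finset.mem_univ C)
          _ ≤ Nat.card (LocalH.internalEdgeGraph v Γ).edgeSet :=
              SimpleGraph.sum_card_edgeSet_toSimpleGraph_le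
          _ ≤ C.supp.ncard := by
              rw [h2]
              exact Set.ncard_le_ncard (fun w _ => hall w) (Set.toFinite _)
          _ = Nat.card C := (Nat.card_coe_set_eq _).symm
      obtain ⟨h3, hcyc⟩ := LocalH.eq_three_and_hasUniqueSimpleThreeCycle hd hΓ hco hD hcard
      refine ⟨h3, fun w hw => ?_, hcyc⟩
      have : (LocalH.carrier v {(w : E)}).card + 1 = d := hC₀ w hw
      rw [LocalH.excess_singleton]
      omega
  refine ⟨hmain, fun h4 C => ?_⟩
  rcases hmain C with h | ⟨h, -⟩
  · have hiff : ∀ w : (LocalH.internalEdges v Γ).support,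
        2 ≤ ((d : ℤ) - 1) - LocalH.simplexDim (LocalH.carrier v {(w : E)}) ↔
          LocalH.excess v {(w : E)} < (d : ℤ) - 2 := by
      intro w
      rw [LocalH.excess_singleton, LocalH.simplexDim]
      omega
    simpa only [hiff] using h
  · omega
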